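/- Let $M^n$ be a simply connected smooth manifold (connected, Hausdorff, second countable) with a smooth Riemannian metric $\langle\,,\rangle$ and Levi-Civita connection $\nabla$. Let $f:M^n\to\mathbb R^{n+1}$ be a smooth isometric immersion, let $N$ be a smooth unit normal vector field along $f$, and let $A$ be the associated shape operator, given by $dN(X)=-df(AX)$. Assume that $\operatorname{rank}A\ge 3$ at every point. Let $Q$ be a non-singular Codazzi tensor, i.e. a smooth $(1,1)$-tensor field, self-adjoint with respect to $\langle\,,\rangle$ and invertible at every point, such that $(\nabla_XQ)Y=(\nabla_YQ)X$ for all smooth vector fields $X,Y$. Let $\widetilde{\langle X,Y\rangle}=\langle Q^2X,Y\rangle$. Then $\widetilde{\langle\,,\rangle}$ is a Riemannian metric on $M^n$ and the following hold. (i) $(M^n,\widetilde{\langle\,,\rangle})$ admits a smooth isometric immersion into $\mathbb R^{n+1}$ if and only if $QA=AQ$. If $\tilde f:(M^n,\widetilde{\langle\,,\rangle})\to\mathbb R^{n+1}$ is such an isometric immersion, then $\tilde f$ is rigid, i.e. every smooth isometric immersion of $(M^n,\widetilde{\langle\,,\rangle})$ into $\mathbb R^{n+1}$ is of the form $\tau\circ\tilde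 f$ with $\tau$ an isometry of $\mathbb R^{n+1}$. Moreover $\tilde f$ has a smooth unit normal vector field, and the shape operator $\tilde A$ of $\tilde f$ associated with any smooth unit normal vector field is $\tilde A=Q^{-1}A$ on all of $M^n$ or $\tilde A=-Q^{-1}A$ on all of $M^n$. (ii) If $QA=AQ$, then there exist smooth functions $g,h:M^n\to\mathbb R$ such that $A(\operatorname{grad}g)=-\operatorname{grad}h$ and $QX=\nabla_X\operatorname{grad}g-hAX$ for every tangent vector $X$, where gradients are taken with respect to $\langle\,,\rangle$. For any such pair $g,h$, every smooth isometric immersion $\tilde f:(M^n,\widetilde{\langle\,,\rangle})\to\mathbb R^{n+1}$ is of the form $\tilde f=\tau\circ F$, where $\tau$ is an isometry of $\mathbb R^{n+1}$ and $F=df(\operatorname{grad}g)+hN$. -/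

import Mathlib

open Bundle Manifold ContDiff VectorField

noncomputable section

namespace CodazziHypersurface

/-- A smooth (`C^∞`) Riemannian metric on the `n`-dimensional manifold `M`. -/
abbrev Metric (n : ℕ) (M : Type*) [TopologicalSpace M] [ChartedSpace (EuclideanSpace ℝ (Fin n)) M]
    [IsManifold (𝓡 n) ∞ M] :=
  ContMDiffRiemannianMetric (𝓡 n) ∞ (EuclideanSpace ℝ (Fin n))
    (fun p : M => TangentSpace (𝓡 n) p)

section

variable {n : ℕ} {M : Type*} [TopologicalSpace M] [ChartedSpace (EuclideanSpace ℝ (Fin n)) M]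
  [IsManifold (𝓡 n) ∞ M]

/-- A real-valued linear form on a tangent space is represented by a unique vector. -/
theorem exists_riesz (met : Metric n M) (p : M) (φ : TangentSpace (𝓡 n) p →L[ℝ] ℝ) :
    ∃ v : TangentSpace (𝓡 n) p, ∀ w, met.inner p v w = φ w := by
  have : FiniteDimensional ℝ (TangentSpace (𝓡 n) p) :=
    inferInstanceAs (FiniteDimensional ℝ (EuclideanSpace ℝ (Fin n)))
  let L : TangentSpace (𝓡 n) p →ₗ[ℝ] Module.Dual ℝ (TangentSpace (𝓡 n) p) :=
    { toFun := fun v => (met.inner p v).toLinearMap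
      map_add' := fun v w => by ext; simp
      map_smul' := fun c v => by ext; simp }
  have hL : Function.Injective L := by
    rw [injective_iff_map_eq_zero]
    intro v hv
    by_contra h
    have h1 := met.pos p v h
    have h2 : met.inner p v v = L v v := rfl
    rw [h2, hv] at h1
    simp at h1
  have hs : Function.Surjective L :=
    (LinearMap.injective_iff_surjective_of_finrank_eq_finrank
      (Subspace.dual_finrank_eq (K := ℝ) (V := TangentSpace (𝓡 n) p)).symm).1 hL
  obtain ⟨v, hv⟩ := hs φ.toLinearMap
  exact ⟨v, fun w => congrArg (fun ψ : Module.Dual ℝ (TangentSpace (𝓡 n) p) => ψ w) hv⟩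

theorem eq_of_inner_eq (met : Metric n M) (p : M) {v v' : TangentSpace (𝓡 n) p}
    (h : ∀ w, met.inner p v w = met.inner p v' w) : v = v' := by
  by_contra hne
  have h1 := met.pos p (v - v') (sub_ne_zero.2 hne)
  have h2 := h (v - v')
  rw [map_sub (met.inner p) v v', sub_apply, h2] at h1
  simp at h1

/-- The vector representing a linear form with respect to the metric. -/
def sharp (met : Metric n M) (p : M) (φ : TangentSpace (𝓡 n) p →L[ℝ] ℝ) : TangentSpace (𝓡 n) p :=
  (exists_riesz met p φ).choose

theorem inner_sharp (met : Metric n M) (p : M) (φ : TangentSpace (𝓡 n) p →L[ℝ] ℝ)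
    (w : TangentSpace (𝓡 n) p) : met.inner p (sharp met p φ) w = φ w :=
  (exists_riesz met p φ).choose_spec w

/-- The gradient of a function: `⟨grad u, w⟩ = du(w)`. -/
def grad (met : Metric n M) (u : M → ℝ) (p : M) : TangentSpace (𝓡 n) p :=
  sharp met p (mvfderiv (𝓡 n) u p)

/-- The vector field `X` is differentiable at `p`. -/
abbrev DiffAt (X : Π p : M, TangentSpace (𝓡 n) p) (p : M) : Prop :=
  MDifferentiableAt (𝓡 n) (𝓡 n).tangent
    (fun q => TotalSpace.mk' (EuclideanSpace ℝ (Fin n)) q (X q)) p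

/-- The vector field `X` is smooth. -/
abbrev SmoothField (X : Π p : M, TangentSpace (𝓡 n) p) : Prop :=
  ContMDiff (𝓡 n) (𝓡 n).tangent ∞
    (fun q => TotalSpace.mk' (EuclideanSpace ℝ (Fin n)) q (X q))

/-- The function `⟨X, Y⟩`. -/
def pairing (met : Metric n M) (X Y : Π p : M, TangentSpace (𝓡 n) p) : M → ℝ :=
  fun p => met.inner p (X p) (Y p)

theorem mdiffAt_pairing (met : Metric n M) {X Y : Π p : M, TangentSpace (𝓡 n) p} {p : M}
    (hX : DiffAt X p) (hY : DiffAt Y p) :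
    MDifferentiableAt (𝓡 n) 𝓘(ℝ) (pairing met X Y) p := by
  have : MDifferentiableAt (𝓡 n) ((𝓡 n).prod 𝓘(ℝ))
      (fun m ↦ TotalSpace.mk' ℝ (E := Bundle.Trivial M ℝ) m (met.inner m (X m) (Y m))) p := by
    apply MDifferentiableAt.clm_bundle_apply₂ (F₁ := EuclideanSpace ℝ (Fin n))
      (F₂ := EuclideanSpace ℝ (Fin n))
    · exact met.contMDiff.mdifferentiableAt (by simp)
    · exact hX
    · exact hY
  rw [mdifferentiableAt_totalSpace] at this
  exact this.2

theorem pairing_comm (met : Metric n M) (X Y : Π p : M, TangentSpace (𝓡 n) p) :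
    pairing met X Y = pairing met Y X := by
  funext p; exact met.symm p _ _

theorem dpairing_add (met : Metric n M) {X X' Y : Π p : M, TangentSpace (𝓡 n) p} {p : M}
    (hX : DiffAt X p) (hX' : DiffAt X' p) (hY : DiffAt Y p) :
    mvfderiv (𝓡 n) (pairing met (X + X') Y) p =
      mvfderiv (𝓡 n) (pairing met X Y) p + mvfderiv (𝓡 n) (pairing met X' Y) p := by
  rw [← mvfderiv_add (mdiffAt_pairing met hX hY) (mdiffAt_pairing met hX' hY)]
  congr 1
  funext q
  simp [pairing]

theorem dpairing_smul (met : Metric n M) {X Y : Π p : M, TangentSpace (𝓡 n) p} {f : M → ℝ} {p : M}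
    (hf : MDifferentiableAt (𝓡 n) 𝓘(ℝ) f p) (hX : DiffAt X p) (hY : DiffAt Y p) :
    mvfderiv (𝓡 n) (pairing met (f • X) Y) p =
      f p • mvfderiv (𝓡 n) (pairing met X Y) p +
        met.inner p (X p) (Y p) • mvfderiv (𝓡 n) f p := by
  change _ = f p • mvfderiv (𝓡 n) (pairing met X Y) p + pairing met X Y p • mvfderiv (𝓡 n) f p
  rw [← mvfderiv_mul hf (mdiffAt_pairing met hX hY)]
  congr 1
  funext q
  simp [pairing]

theorem dpairing_add' (met : Metric n M) {X X' Y : Π p : M, TangentSpace (𝓡 n) p} {p : M}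
    (hX : DiffAt X p) (hX' : DiffAt X' p) (hY : DiffAt Y p) :
    mvfderiv (𝓡 n) (pairing met Y (X + X')) p =
      mvfderiv (𝓡 n) (pairing met Y X) p + mvfderiv (𝓡 n) (pairing met Y X') p := by
  rw [pairing_comm, dpairing_add met hX hX' hY, pairing_comm met X, pairing_comm met X']

theorem dpairing_smul' (met : Metric n M) {X Y : Π p : M, TangentSpace (𝓡 n) p} {f : M → ℝ} {p : M}
    (hf : MDifferentiableAt (𝓡 n) 𝓘(ℝ) f p) (hX : DiffAt X p) (hY : DiffAt Y p) :
    mvfderiv (𝓡 n) (pairing met Y (f • X)) p =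
      f p • mvfderiv (𝓡 n) (pairing met Y X) p +
        met.inner p (Y p) (X p) • mvfderiv (𝓡 n) f p := by
  rw [pairing_comm, dpairing_smul met hf hX hY, pairing_comm met X, met.symm p (X p)]

/-- The right-hand side of the Koszul formula, equal to `2⟨∇_X Y, Z⟩`. -/
def koszul (met : Metric n M) (Y X Z : Π p : M, TangentSpace (𝓡 n) p) (p : M) : ℝ :=
  mvfderiv (𝓡 n) (pairing met Y Z) p (X p) + mvfderiv (𝓡 n) (pairing met X Z) p (Y p)
    - mvfderiv (𝓡 n) (pairing met X Y) p (Z p)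
    + met.inner p (mlieBracket (𝓡 n) X Y p) (Z p) - met.inner p (mlieBracket (𝓡 n) X Z p) (Y p)
    - met.inner p (mlieBracket (𝓡 n) Y Z p) (X p)

theorem koszul_tensorial₁ (met : Metric n M) {Y Z : Π p : M, TangentSpace (𝓡 n) p} {p : M}
    (hY : DiffAt Y p) (hZ : DiffAt Z p) :
    TensorialAt (𝓡 n) (EuclideanSpace ℝ (Fin n)) (fun X => koszul met Y X Z p) p where
  smul {f X} hf hX := by
    have : IsManifold (𝓡 n) 2 M := IsManifold.of_le (n := ∞) (by norm_cast)
    simp only [koszul, dpairing_smul met hf hX hZ, dpairing_smul met hf hX hY,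
      mlieBracket_smul_left hf hX]
    simp
    ring
  add {X X'} hX hX' := by
    have : IsManifold (𝓡 n) 2 M := IsManifold.of_le (n := ∞) (by norm_cast)
    simp only [koszul, dpairing_add met hX hX' hZ, dpairing_add met hX hX' hY,
      mlieBracket_add_left hX hX']
    simp
    ring

theorem koszul_tensorial₂ (met : Metric n M) {Y X : Π p : M, TangentSpace (𝓡 n) p} {p : M}
    (hY : DiffAt Y p) (hX : DiffAt X p) :
    TensorialAt (𝓡 n) (EuclideanSpace ℝ (Fin n)) (fun Z => koszul met Y X Z p) p where
  smul {f Z} hf hZ := by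
    have : IsManifold (𝓡 n) 2 M := IsManifold.of_le (n := ∞) (by norm_cast)
    simp only [koszul, dpairing_smul' met hf hZ hX, dpairing_smul' met hf hZ hY,
      mlieBracket_smul_right hf hZ]
    simp [met.symm p (Z p)]
    ring
  add {Z Z'} hZ hZ' := by
    have : IsManifold (𝓡 n) 2 M := IsManifold.of_le (n := ∞) (by norm_cast)
    simp only [koszul, dpairing_add' met hZ hZ' hX, dpairing_add' met hZ hZ' hY,
      mlieBracket_add_right hZ hZ']
    simp
    ring

open Classical in
/-- Half of the Koszul form of `Y`, as a bilinear form in `X` and `Z`. -/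
def koszulForm (met : Metric n M) (Y : Π p : M, TangentSpace (𝓡 n) p) (p : M) :
    TangentSpace (𝓡 n) p →L[ℝ] TangentSpace (𝓡 n) p →L[ℝ] ℝ :=
  if hY : DiffAt Y p then
    (1 / 2 : ℝ) • TensorialAt.mkHom₂ (I := 𝓡 n) (F := EuclideanSpace ℝ (Fin n))
      (F' := EuclideanSpace ℝ (Fin n))
      (fun X Z => koszul met Y X Z p) p
      (fun _ hZ => koszul_tensorial₁ met hY hZ) (fun _ hX => koszul_tensorial₂ met hY hX)
  else 0

theorem koszulForm_apply (met : Metric n M) {Y X Z : Π p : M, TangentSpace (𝓡 n) p} {p : M} (hY : DiffAt Y p)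
    (hX : DiffAt X p) (hZ : DiffAt Z p) :
    2 * koszulForm met Y p (X p) (Z p) = koszul met Y X Z p := by
  have h := TensorialAt.mkHom₂_apply (I := 𝓡 n) (F := EuclideanSpace ℝ (Fin n))
    (F' := EuclideanSpace ℝ (Fin n)) (Φ := fun X Z => koszul met Y X Z p) (x := p)
    (fun _ hZ => koszul_tensorial₁ met hY hZ) (fun _ hX => koszul_tensorial₂ met hY hX) hX hZ
  rw [koszulForm, dif_pos hY]
  simp only [smul_apply, smul_eq_mul]
  rw [h]
  ring

/-- Every tangent vector extends to a vector field that is differentiable at its base point. -/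
theorem exists_field (p : M) (v : TangentSpace (𝓡 n) p) : ∃ X : Π p : M, TangentSpace (𝓡 n) p, DiffAt X p ∧ X p = v :=
  ⟨FiberBundle.extend (EuclideanSpace ℝ (Fin n)) v, FiberBundle.mdifferentiableAt_extend .., by simp⟩

/-- The linear map `X ↦ ∇_X Y` determined by the Koszul formula. -/
def nablaFun (met : Metric n M) (Y : Π p : M, TangentSpace (𝓡 n) p) (p : M) :
    TangentSpace (𝓡 n) p →L[ℝ] TangentSpace (𝓡 n) p :=
  have : FiniteDimensional ℝ (TangentSpace (𝓡 n) p) :=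
    inferInstanceAs (FiniteDimensional ℝ (EuclideanSpace ℝ (Fin n)))
  have : T2Space (TangentSpace (𝓡 n) p) :=
    inferInstanceAs (T2Space (EuclideanSpace ℝ (Fin n)))
  LinearMap.toContinuousLinearMap
    { toFun := fun v => sharp met p (koszulForm met Y p v)
      map_add' := fun v w => eq_of_inner_eq met p fun z => by simp [inner_sharp]
      map_smul' := fun c v => eq_of_inner_eq met p fun z => by simp [inner_sharp] }

theorem inner_nablaFun (met : Metric n M) (Y : Π p : M, TangentSpace (𝓡 n) p) (p : M) (v w : TangentSpace (𝓡 n) p) :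
    met.inner p (nablaFun met Y p v) w = koszulForm met Y p v w :=
  inner_sharp met p _ w

theorem inner_nablaFun_field (met : Metric n M) {Y X Z : Π p : M, TangentSpace (𝓡 n) p} {p : M} (hY : DiffAt Y p)
    (hX : DiffAt X p) (hZ : DiffAt Z p) :
    2 * met.inner p (nablaFun met Y p (X p)) (Z p) = koszul met Y X Z p := by
  rw [inner_nablaFun, koszulForm_apply met hY hX hZ]

/-- The Levi-Civita connection of the metric, given by the Koszul formula
(Mathlib's `∇ Y p (X p)` is `(∇_X Y)(p)`). -/
def leviCivita (met : Metric n M) :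
    CovariantDerivative (𝓡 n) (EuclideanSpace ℝ (Fin n)) (fun p : M => TangentSpace (𝓡 n) p) where
  toFun := nablaFun met
  isCovariantDerivativeOnUniv :=
    { add := by
        intro Y Y' p hY hY' _
        ext1 v
        refine eq_of_inner_eq met p fun w => ?_
        obtain ⟨X, hX, rfl⟩ := exists_field p v
        obtain ⟨Z, hZ, rfl⟩ := exists_field p w
        have : IsManifold (𝓡 n) 2 M := IsManifold.of_le (n := ∞) (by norm_cast)
        have h := inner_nablaFun_field met (mdifferentiableAt_add_section hY hY') hX hZ
        have h1 := inner_nablaFun_field met hY hX hZ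
        have h2 := inner_nablaFun_field met hY' hX hZ
        have h3 : koszul met (Y + Y') X Z p = koszul met Y X Z p + koszul met Y' X Z p := by
          simp only [koszul, dpairing_add met hY hY' hZ, dpairing_add' met hY hY' hX,
            mlieBracket_add_right hY hY', mlieBracket_add_left hY hY']
          simp
          ring
        simp only [add_apply, map_add]
        linarith
      leibniz := by
        intro Y f p hY hf _
        ext1 v
        refine eq_of_inner_eq met p fun w => ?_
        obtain ⟨X, hX, rfl⟩ := exists_field p v
        obtain ⟨Z, hZ, rfl⟩ := exists_field p w
        have : IsManifold (𝓡 n) 2 M := IsManifold.of_le (n := ∞) (by norm_cast)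
        have h := inner_nablaFun_field met (hf.smul_section hY) hX hZ
        have h1 := inner_nablaFun_field met hY hX hZ
        have h3 : koszul met (f • Y) X Z p = f p * koszul met Y X Z p +
            2 * (mvfderiv (𝓡 n) f p (X p) * met.inner p (Y p) (Z p)) := by
          simp only [koszul, dpairing_smul met hf hY hZ, dpairing_smul' met hf hY hX,
            mlieBracket_smul_right hf hY, mlieBracket_smul_left hf hY]
          simp [met.symm p (Y p) (X p)]
          ring
        rw [h3, ← h1] at h
        simp only [add_apply, map_add, smul_apply, map_smul, ContinuousLinearMap.smulRight_apply,
          smul_eq_mul]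
        linarith }

theorem inner_leviCivita (met : Metric n M) {Y X Z : Π p : M, TangentSpace (𝓡 n) p} {p : M} (hY : DiffAt Y p)
    (hX : DiffAt X p) (hZ : DiffAt Z p) :
    2 * met.inner p (leviCivita met Y p (X p)) (Z p) = koszul met Y X Z p :=
  inner_nablaFun_field met hY hX hZ

/-- The Levi-Civita connection is torsion-free. -/
theorem leviCivita_torsion (met : Metric n M) {X Y : Π p : M, TangentSpace (𝓡 n) p} {p : M} (hX : DiffAt X p)
    (hY : DiffAt Y p) :
    leviCivita met Y p (X p) - leviCivita met X p (Y p) = mlieBracket (𝓡 n) X Y p := by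
  refine eq_of_inner_eq met p fun w => ?_
  obtain ⟨Z, hZ, rfl⟩ := exists_field p w
  have h1 := inner_leviCivita met hY hX hZ
  have h2 := inner_leviCivita met hX hY hZ
  have h3 : koszul met Y X Z p - koszul met X Y Z p =
      2 * met.inner p (mlieBracket (𝓡 n) X Y p) (Z p) := by
    simp only [koszul, pairing_comm met Y X, mlieBracket_swap_apply (V := Y) (W := X)]
    simp
    ring
  simp only [map_sub, sub_apply]
  linarith

/-- The Levi-Civita connection is compatible with the metric. -/
theorem leviCivita_metric (met : Metric n M) {X Y Z : Π p : M, TangentSpace (𝓡 n) p} {p : M} (hX : DiffAt X p)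
    (hY : DiffAt Y p) (hZ : DiffAt Z p) :
    mvfderiv (𝓡 n) (fun q => met.inner q (Y q) (Z q)) p (X p) =
      met.inner p (leviCivita met Y p (X p)) (Z p) +
        met.inner p (Y p) (leviCivita met Z p (X p)) := by
  have h1 := inner_leviCivita met hY hX hZ
  have h2 := inner_leviCivita met hZ hX hY
  have h3 : koszul met Y X Z p + koszul met Z X Y p =
      2 * mvfderiv (𝓡 n) (pairing met Y Z) p (X p) := by
    simp only [koszul, pairing_comm met Z Y, mlieBracket_swap_apply (V := Z) (W := Y)]
    simp
    ring
  rw [met.symm p (Y p)]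
  change mvfderiv (𝓡 n) (pairing met Y Z) p (X p) = _
  linarith

/-- The (1,1)-tensor field `Q` is smooth. -/
def SmoothTensor (Q : Π p : M, TangentSpace (𝓡 n) p →L[ℝ] TangentSpace (𝓡 n) p) : Prop :=
  ContMDiff (𝓡 n)
    ((𝓡 n).prod 𝓘(ℝ, EuclideanSpace ℝ (Fin n) →L[ℝ] EuclideanSpace ℝ (Fin n))) ∞
    (fun p => TotalSpace.mk' (EuclideanSpace ℝ (Fin n) →L[ℝ] EuclideanSpace ℝ (Fin n))
      (E := fun q : M => TangentSpace (𝓡 n) q →L[ℝ] TangentSpace (𝓡 n) q) p (Q p))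

/-- The covariant derivative `(∇_X Q) Y = ∇_X (QY) - Q (∇_X Y)` of a (1,1)-tensor field. -/
def covDeriv (met : Metric n M)
    (Q : Π p : M, TangentSpace (𝓡 n) p →L[ℝ] TangentSpace (𝓡 n) p)
    (X Y : Π p : M, TangentSpace (𝓡 n) p) (p : M) : TangentSpace (𝓡 n) p :=
  leviCivita met (fun q => Q q (Y q)) p (X p) - Q p (leviCivita met Y p (X p))

/-- A Codazzi tensor: a smooth self-adjoint (1,1)-tensor field with `(∇_X Q) Y = (∇_Y Q) X`. -/
structure IsCodazzi (met : Metric n M)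
    (Q : Π p : M, TangentSpace (𝓡 n) p →L[ℝ] TangentSpace (𝓡 n) p) : Prop where
  smooth : SmoothTensor Q
  selfAdjoint : ∀ (p : M) (v w : TangentSpace (𝓡 n) p),
    met.inner p (Q p v) w = met.inner p v (Q p w)
  codazzi : ∀ X Y : Π p : M, TangentSpace (𝓡 n) p, SmoothField X → SmoothField Y →
    ∀ p, covDeriv met Q X Y p = covDeriv met Q Y X p

theorem contMDiff_inner_sq (met : Metric n M)
    {Q : Π p : M, TangentSpace (𝓡 n) p →L[ℝ] TangentSpace (𝓡 n) p} (hQ : SmoothTensor Q) :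
    ContMDiff (𝓡 n) ((𝓡 n).prod 𝓘(ℝ, EuclideanSpace ℝ (Fin n) →L[ℝ]
        EuclideanSpace ℝ (Fin n) →L[ℝ] ℝ)) ∞
      (fun p : M => TotalSpace.mk' (EuclideanSpace ℝ (Fin n) →L[ℝ] EuclideanSpace ℝ (Fin n) →L[ℝ] ℝ)
        (E := fun q : M => TangentSpace (𝓡 n) q →L[ℝ] TangentSpace (𝓡 n) q →L[ℝ] ℝ) p
        (met.inner p ∘L (Q p ∘L Q p))) := by
  intro p₀
  have hg := met.contMDiff p₀
  have hq := hQ p₀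
  rw [contMDiffAt_hom_bundle] at hg hq ⊢
  refine ⟨contMDiffAt_id, ?_⟩
  have hcomp := (hg.2.clm_comp hq.2).clm_comp hq.2
  refine hcomp.congr_of_eventuallyEq ?_
  have hmem : (trivializationAt (EuclideanSpace ℝ (Fin n))
      (fun q : M => TangentSpace (𝓡 n) q) p₀).baseSet ∈ nhds p₀ :=
    (trivializationAt (EuclideanSpace ℝ (Fin n))
      (fun q : M => TangentSpace (𝓡 n) q) p₀).open_baseSet.mem_nhds
      (FiberBundle.mem_baseSet_trivializationAt' p₀)
  filter_upwards [hmem] with p hp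
  have key : ∀ z : TangentSpace (𝓡 n) p,
      (trivializationAt (EuclideanSpace ℝ (Fin n)) (fun q : M => TangentSpace (𝓡 n) q) p₀).symmL ℝ p
        ((trivializationAt (EuclideanSpace ℝ (Fin n))
          (fun q : M => TangentSpace (𝓡 n) q) p₀).continuousLinearMapAt ℝ p z) = z :=
    fun z => Trivialization.symmL_continuousLinearMapAt _ hp z
  ext v w
  simp only [ContinuousLinearMap.inCoordinates, ContinuousLinearMap.comp_apply]
  rw [key, key]

/-- The Riemannian metric `(X, Y) ↦ ⟨Q² X, Y⟩` of a non-singular Codazzi tensor `Q`. -/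
def sqMetric (met : Metric n M) (Q : Π p : M, TangentSpace (𝓡 n) p →L[ℝ] TangentSpace (𝓡 n) p)
    (hQ : IsCodazzi met Q) (hns : ∀ p, (Q p).IsInvertible) : Metric n M where
  inner p := met.inner p ∘L (Q p ∘L Q p)
  symm p v w := by
    simp only [ContinuousLinearMap.comp_apply]
    rw [hQ.selfAdjoint, hQ.selfAdjoint, met.symm]
  pos p v hv := by
    simp only [ContinuousLinearMap.comp_apply]
    rw [hQ.selfAdjoint]
    exact met.pos p _ fun h => hv ((hns p).injective (by rw [h, map_zero]))
  isVonNBounded p := by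
    obtain ⟨e, he⟩ := hns p
    have h := (met.isVonNBounded p).image
      (e.symm : TangentSpace (𝓡 n) p →L[ℝ] TangentSpace (𝓡 n) p)
    refine h.subset fun v hv => (Set.mem_image _ _ _).2 ⟨e v, ?_, e.symm_apply_apply v⟩
    have h1 : (met.inner p ∘L (Q p ∘L Q p)) v v < 1 := hv
    simp only [ContinuousLinearMap.comp_apply] at h1
    rw [hQ.selfAdjoint, ← he] at h1
    exact h1
  contMDiff := contMDiff_inner_sq met hQ.smooth

theorem sqMetric_apply (met : Metric n M)
    (Q : Π p : M, TangentSpace (𝓡 n) p →L[ℝ] TangentSpace (𝓡 n) p) (hQ : IsCodazzi met Q)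
    (hns : ∀ p, (Q p).IsInvertible) (p : M) (v w : TangentSpace (𝓡 n) p) :
    (sqMetric met Q hQ hns).inner p v w = met.inner p (Q p (Q p v)) w := rfl

/-- `f` is a smooth isometric immersion of `(M, met)` into `ℝⁿ⁺¹`
(that `df` is injective follows from the positivity of the metric). -/
structure IsIsometricImmersion (met : Metric n M) (f : M → EuclideanSpace ℝ (Fin (n + 1))) :
    Prop where
  smooth : ContMDiff (𝓡 n) 𝓘(ℝ, EuclideanSpace ℝ (Fin (n + 1))) ∞ f
  isometric : ∀ (p : M) (v w : TangentSpace (𝓡 n) p),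
    inner ℝ (mvfderiv (𝓡 n) f p v) (mvfderiv (𝓡 n) f p w) = met.inner p v w

/-- `N` is a smooth unit normal vector field along `f`. -/
structure IsUnitNormal (f N : M → EuclideanSpace ℝ (Fin (n + 1))) : Prop where
  smooth : ContMDiff (𝓡 n) 𝓘(ℝ, EuclideanSpace ℝ (Fin (n + 1))) ∞ N
  norm_eq : ∀ p, ‖N p‖ = 1
  normal : ∀ (p : M) (v : TangentSpace (𝓡 n) p), inner ℝ (N p) (mvfderiv (𝓡 n) f p v) = 0

/-- `A` is the shape operator of `f` associated with `N`, i.e. it is given by the Weingarten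
formula `dN(v) = -df(A v)`. As `df` is injective, `f` and `N` determine `A`. -/
def IsShapeOperator (f N : M → EuclideanSpace ℝ (Fin (n + 1)))
    (A : Π p : M, TangentSpace (𝓡 n) p →L[ℝ] TangentSpace (𝓡 n) p) : Prop :=
  ∀ (p : M) (v : TangentSpace (𝓡 n) p), mvfderiv (𝓡 n) N p v = -mvfderiv (𝓡 n) f p (A p v)

/-- The smooth functions `u` and `h` satisfy `A(grad u) = -grad h` and
`Q X = ∇_X (grad u) - h A X`. -/
structure IsPotentialPair (met : Metric n M)
    (A Q : Π p : M, TangentSpace (𝓡 n) p →L[ℝ] TangentSpace (𝓡 n) p) (u h : M → ℝ) : Prop where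
  smooth_left : ContMDiff (𝓡 n) 𝓘(ℝ) ∞ u
  smooth_right : ContMDiff (𝓡 n) 𝓘(ℝ) ∞ h
  shape_grad : ∀ p, A p (grad met u p) = -grad met h p
  hessian : ∀ (p : M) (v : TangentSpace (𝓡 n) p),
    Q p v = leviCivita met (grad met u) p v - h p • A p v

end

end CodazziHypersurface

end

open CodazziHypersurface

open scoped RealInnerProductSpace Topology

/-! Everything is read off the vector-valued 1-form `df ∘ Q`. Its Gram form is the metric `⟨Q²·,
·⟩`, because `Q` is self-adjoint. By the Gauss formula its exterior derivative on `X, Y` has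
tangential part `df ((∇_X Q) Y - (∇_Y Q) X)`, which vanishes by the Codazzi equation, and normal
part `(⟨AX, QY⟩ - ⟨AY, QX⟩) N` (`fderiv_pullForm_codazzi`). Since `A` and `Q` are self-adjoint, the
normal part vanishes exactly when `QA = AQ`. In that case the Poincaré lemma on the simply connected
`M` gives `F` with `dF = df ∘ Q`, and `F` is an isometric immersion of the new metric.

The core is that every isometric immersion `f'` of the new metric satisfies `df' = Ψ ∘ df ∘ Q` for
one fixed linear isometry `Ψ`, without assuming commutation. This is a Beez–Killing argument in
coordinates, comparing the frames `T = df ∘ Q` and `T' = df'`. The torsion of `T` is normal, so the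
Koszul argument still shows that the tangential parts of `DT` and `DT'` have the same components
(`inner_fderiv_eq_of_gram_eq`). Differentiating once more gives equal Gauss expressions
(`inner_fderiv_sub_eq_of_gram_eq`). Hence the normal parts, which are bilinear forms not assumed
symmetric, have the same `2 × 2` minors. The one for `T` is `⟨AX, QY⟩`, of rank at least three, so
the two agree up to sign (`eq_or_eq_neg_of_minors_eq`). At each point some linear isometry therefore
carries `T` to `T'` and `DT` to `DT'`. Differentiating these relations shows that it is locally
constant (`hasFDerivAt_zero_of_intertwine`). The local isometries match, because the tangent planes
near a point with `A ≠ 0` determine them, and connectedness makes `Ψ` global.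

The rest follows from `df' = Ψ ∘ df ∘ Q`. Closedness of `df'` forces `df ∘ Q` to be closed, hence
`QA = AQ`. Two immersions have differentials related by a linear isometry, so they differ by a rigid
motion. The normal is `± Ψ N`, with shape operator `± Q⁻¹A`. For (ii), a primitive `F` of `df ∘ Q`
is split into tangential and normal parts. The form `⟨F, df⟩` is closed because `Q` is self-adjoint,
so the tangential part is `df (grad g)`; with `h = ⟨F, N⟩`, the two components of `dF = df ∘ Q` are
the required equations. Conversely, any such pair makes `df (grad g) + hN` a primitive of `df ∘ Q`.
-/

/-! ### Bilinear forms with equal minors -/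

/-- Two bilinear forms with the same `2 × 2` minors agree up to sign if one of them has rank at
least three. -/
theorem eq_or_eq_neg_of_minors_eq {E : Type*} (β β' : E → E → ℝ)
    (h : ∀ x y w z, β x y * β w z - β w y * β x z = β' x y * β' w z - β' w y * β' x z)
    (a b : Fin 3 → E) (hab : ∀ i j, β (a i) (b j) = if i = j then 1 else 0) :
    (∀ x y, β' x y = β x y) ∨ (∀ x y, β' x y = -β x y) := by
  obtain ⟨d, hd2, hd⟩ : ∃ d : ℝ, d * d = 1 ∧
      ∀ i j, β' (a i) (b j) = d * β (a i) (b j) := by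
    have m : ∀ i j k l : Fin 3, β' (a i) (b j) * β' (a k) (b l) - β' (a k) (b j) * β' (a i) (b l)
        = (if i = j then 1 else 0) * (if k = l then 1 else 0)
          - (if k = j then 1 else 0) * (if i = l then 1 else 0) := fun i j k l => by
      rw [← h]; simp only [hab]
    simp only [hab]
    have e1 := m 0 0 1 1
    have e2 := m 0 0 1 2
    have e3 := m 0 1 1 2
    have e4 := m 0 0 2 1
    have e5 := m 0 0 2 2
    have e6 := m 0 1 2 2
    have e7 := m 1 0 2 1
    have e8 := m 1 0 2 2
    have e9 := m 1 1 2 2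
    simp only [Fin.isValue, if_true, Fin.reduceEq, if_false] at e1 e2 e3 e4 e5 e6 e7 e8 e9
    set b00 := β' (a 0) (b 0)
    set b01 := β' (a 0) (b 1)
    set b02 := β' (a 0) (b 2)
    set b10 := β' (a 1) (b 0)
    set b11 := β' (a 1) (b 1)
    set b12 := β' (a 1) (b 2)
    set b20 := β' (a 2) (b 0)
    set b21 := β' (a 2) (b 1)
    set b22 := β' (a 2) (b 2)
    -- Laplace expansion of a vanishing `3 × 3` determinant with row 0 repeated: the minors of rows
    -- 0 and 2 are those of the identity matrix, so only the entry `b01` survives. The third index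
    -- is what makes this possible.
    have h01 : b01 = 0 := by linear_combination b00 * e6 + b02 * e4 - b01 * e5
    have h02 : b02 = 0 := by grind
    have h10 : b10 = 0 := by grind
    have h12 : b12 = 0 := by grind
    have h20 : b20 = 0 := by grind
    have h21 : b21 = 0 := by grind
    have h11 : b11 = b00 := by grind
    have h22 : b22 = b00 := by grind
    refine ⟨b00, by grind, fun i j => ?_⟩
    fin_cases i <;> fin_cases j <;> simp <;> first | rfl | assumption
  have other : ∀ i : Fin 3, ∃ j : Fin 3, i ≠ j := by decide
  -- The minor on rows `a i`, `x` and columns `b i`, `b j` with `i ≠ j` has a zero off-diagonal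
  -- entry at `(a i, b j)`, so it reduces to a multiple of the entry at `(x, b j)`. The same device
  -- gives `hcol`, and then a minor through `(a 0, b 0)` gives every entry.
  have hrow : ∀ x j, β' x (b j) = d * β x (b j) := by
    intro x j
    obtain ⟨i, hi⟩ := other j
    have := h (a i) (b i) x (b j)
    simp only [hd, hab, if_neg hi.symm] at this
    simp at this
    linear_combination (-d) * this - β' x (b j) * hd2
  have hcol : ∀ y i, β' (a i) y = d * β (a i) y := by
    intro y i
    obtain ⟨j, hj⟩ := other i
    have := h (a j) (b j) (a i) y
    simp only [hd, hab, if_neg hj] at this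
    simp at this
    linear_combination (-d) * this - β' (a i) y * hd2
  have hall : ∀ x y, β' x y = d * β x y := by
    intro x y
    have := h (a 0) (b 0) x y
    simp only [hrow, hcol, hab] at this
    simp at this
    linear_combination (-d) * this - β' x y * hd2 + d * (β x (b 0) * β (a 0) y) * hd2
  rcases mul_self_eq_one_iff.1 hd2 with rfl | rfl
  · left; intro x y; rw [hall, one_mul]
  · right; intro x y; rw [hall, neg_one_mul]

/-! ### Beez–Killing at a point -/

section Pointwise

variable {E V : Type*} [NormedAddCommGroup E] [NormedSpace ℝ E]
  [NormedAddCommGroup V] [InnerProductSpace ℝ V] [FiniteDimensional ℝ V]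

/-- A vector orthogonal to the image of an injective map into a space of one more dimension and to
a unit normal of this image is zero. -/
theorem eq_zero_of_inner_hyperplane (hdim : Module.finrank ℝ V = Module.finrank ℝ E + 1)
    {T : E →L[ℝ] V} (hT : Function.Injective T) {N : V} (hN : ‖N‖ = 1)
    (hNT : ∀ y, ⟪N, T y⟫ = 0) {v : V} (hv : ∀ y, ⟪v, T y⟫ = 0) (hvN : ⟪v, N⟫ = 0) : v = 0 := by
  have hr : Module.finrank ℝ (LinearMap.range T.toLinearMap) = Module.finrank ℝ E :=
    LinearMap.finrank_range_of_inj hT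
  have hs := (LinearMap.range T.toLinearMap).finrank_add_finrank_orthogonal
  have h1 : Module.finrank ℝ (LinearMap.range T.toLinearMap)ᗮ = 1 := by omega
  have hmem : ∀ w : V, (∀ y, ⟪w, T y⟫ = 0) → w ∈ (LinearMap.range T.toLinearMap)ᗮ := by
    intro w hw
    rw [Submodule.mem_orthogonal']
    rintro _ ⟨y, rfl⟩
    exact hw y
  have hN0 : (⟨N, hmem N hNT⟩ : (LinearMap.range T.toLinearMap)ᗮ) ≠ 0 := by
    intro h
    have h' : N = 0 := congrArg Subtype.val h
    simp [h'] at hN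
  obtain ⟨c, hc⟩ := (finrank_eq_one_iff_of_nonzero' _ hN0).1 h1 ⟨v, hmem v hv⟩
  have hc' : c • N = v := congrArg Subtype.val hc
  rw [← hc', real_inner_smul_left, real_inner_self_eq_norm_sq, hN] at hvN
  have : c = 0 := by simpa using hvN
  rw [← hc', this, zero_smul]

/-- Two injective linear maps with the same Gram matrix differ by a linear isometry. -/
theorem exists_linearIsometry_comp_eq {T T' : E →L[ℝ] V} (hT : Function.Injective T)
    (hg : ∀ x y, ⟪T' x, T' y⟫ = ⟪T x, T y⟫) : ∃ Ψ : V →ₗᵢ[ℝ] V, ∀ y, Ψ (T y) = T' y := by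
  let e := LinearEquiv.ofInjective T.toLinearMap hT
  let L : LinearMap.range T.toLinearMap →ₗᵢ[ℝ] V :=
    (T'.toLinearMap ∘ₗ e.symm.toLinearMap).isometryOfInner (by
      intro x y
      obtain ⟨x, rfl⟩ := e.surjective x
      obtain ⟨y, rfl⟩ := e.surjective y
      simpa [e] using hg x y)
  refine ⟨L.extend, fun y => ?_⟩
  have := L.extend_apply (e y)
  have h2 : L (e y) = T' y := by simp [L]
  rw [h2] at this
  exact this

/-- The pointwise form of the Beez–Killing theorem: second-order data of rank at least three
with the same Gauss equation differ by a linear isometry. -/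
theorem exists_linearIsometry_of_gauss (hdim : Module.finrank ℝ V = Module.finrank ℝ E + 1)
    {T T' : E →L[ℝ] V} {D D' : E → E → V} {N : V} (hT : Function.Injective T)
    (hg : ∀ x y, ⟪T' x, T' y⟫ = ⟪T x, T y⟫) (hN : ‖N‖ = 1) (hNT : ∀ y, ⟪N, T y⟫ = 0)
    (hΓ : ∀ x y z, ⟪D' x y, T' z⟫ = ⟪D x y, T z⟫)
    (hgauss : ∀ x y w z, ⟪D' x y, D' w z⟫ - ⟪D' w y, D' x z⟫ = ⟪D x y, D w z⟫ - ⟪D w y, D x z⟫)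
    (a b : Fin 3 → E) (hab : ∀ i j, ⟪D (a i) (b j), N⟫ = if i = j then 1 else 0) :
    ∃ Ψ : V →ₗᵢ[ℝ] V, (∀ y, Ψ (T y) = T' y) ∧ ∀ x y, Ψ (D x y) = D' x y := by
  obtain ⟨Ψ, hΨ⟩ := exists_linearIsometry_comp_eq hT hg
  have hT' : Function.Injective T' := by
    intro x y hxy
    rw [← hΨ, ← hΨ] at hxy
    exact hT (Ψ.injective hxy)
  have hΨN : ‖Ψ N‖ = 1 := by rw [Ψ.norm_map, hN]
  have hΨNT : ∀ y, ⟪Ψ N, T' y⟫ = 0 := fun y => by rw [← hΨ, Ψ.inner_map_map, hNT]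
  -- Both sides are orthogonal to `Ψ N` and have the same products with every `T' z`, and these
  -- vectors span `V`.
  have htan : ∀ x y, Ψ (D x y - ⟪D x y, N⟫ • N) = D' x y - ⟪D' x y, Ψ N⟫ • Ψ N := by
    intro x y
    rw [← sub_eq_zero]
    refine eq_zero_of_inner_hyperplane hdim hT' hΨN hΨNT (fun z => ?_) ?_
    · rw [inner_sub_left, inner_sub_left (D' x y), real_inner_smul_left, hΨNT, hΓ, ← hΨ z,
        Ψ.inner_map_map, inner_sub_left, real_inner_smul_left, hNT]
      ring
    · rw [inner_sub_left, inner_sub_left (D' x y), real_inner_smul_left, Ψ.inner_map_map,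
        Ψ.inner_map_map, inner_sub_left, real_inner_smul_left, real_inner_self_eq_norm_sq, hN]
      ring
  have hNN : ⟪N, N⟫ = 1 := by rw [real_inner_self_eq_norm_sq, hN]; norm_num
  have hNN' : ⟪Ψ N, Ψ N⟫ = 1 := by rw [Ψ.inner_map_map, hNN]
  -- `Ψ` preserves products of tangential parts. Subtracting these from the Gauss equation leaves
  -- the equality of the `2 × 2` minors of the normal components.
  have hinner : ∀ x y w z, ⟪D' x y, D' w z⟫ - ⟪D' x y, Ψ N⟫ * ⟪D' w z, Ψ N⟫ =
      ⟪D x y, D w z⟫ - ⟪D x y, N⟫ * ⟪D w z, N⟫ := by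
    intro x y w z
    have h := Ψ.inner_map_map (D x y - ⟪D x y, N⟫ • N) (D w z - ⟪D w z, N⟫ • N)
    rw [htan, htan] at h
    simp only [inner_sub_left, inner_sub_right, real_inner_smul_left, real_inner_smul_right, hNN,
      hNN', real_inner_comm _ N, real_inner_comm _ (Ψ N)] at h
    linarith
  have hsign := eq_or_eq_neg_of_minors_eq (fun x y => ⟪D x y, N⟫) (fun x y => ⟪D' x y, Ψ N⟫)
    (fun x y w z => by
      have h1 := hinner x y w z
      have h2 := hinner w y x z
      have h3 := hgauss x y w z
      linarith) a b hab
  -- Stated for an arbitrary isometry extending `T ↦ T'`, since the minus sign below requires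
  -- replacing `Ψ`.
  have key : ∀ Ψ' : V →ₗᵢ[ℝ] V, (∀ y, Ψ' (T y) = T' y) →
      (∀ x y, ⟪D' x y, Ψ' N⟫ = ⟪D x y, N⟫) → ∀ x y, Ψ' (D x y) = D' x y := by
    intro Ψ' hΨ' hβ x y
    rw [← sub_eq_zero]
    refine eq_zero_of_inner_hyperplane (T := T') (N := Ψ' N) hdim hT'
      (by rw [Ψ'.norm_map, hN]) (fun y => by rw [← hΨ', Ψ'.inner_map_map, hNT]) (fun z => ?_) ?_
    · rw [inner_sub_left, hΓ, ← hΨ', Ψ'.inner_map_map, sub_self]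
    · rw [inner_sub_left, hβ, Ψ'.inner_map_map, sub_self]
  rcases hsign with h | h
  · exact ⟨Ψ, hΨ, key Ψ hΨ h⟩
  -- With the minus sign, `Ψ` is precomposed with the reflection in the hyperplane orthogonal to
  -- `N`, which fixes every `T y` and reverses `N`.
  · let R : V ≃ₗᵢ[ℝ] V := (ℝ ∙ N)ᗮ.reflection
    have hRN : R N = -N := Submodule.reflection_orthogonalComplement_singleton_eq_neg N
    have hRT : ∀ y, R (T y) = T y := fun y =>
      Submodule.reflection_mem_subspace_eq_self
        (Submodule.mem_orthogonal_singleton_iff_inner_right.2 (hNT y))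
    have hΨR : ∀ y, (Ψ.comp R.toLinearIsometry) (T y) = T' y := fun y => by
      simp [hRT, hΨ]
    refine ⟨Ψ.comp R.toLinearIsometry, hΨR, key _ hΨR fun x y => ?_⟩
    simp [hRN, h]

end Pointwise

/-! ### Local rigidity of frames -/

section Local

variable {E V : Type*} [NormedAddCommGroup E] [NormedSpace ℝ E]
  [NormedAddCommGroup V] [InnerProductSpace ℝ V]

theorem HasFDerivAt.clm_apply_vector {E F G : Type*} [NormedAddCommGroup E] [NormedSpace ℝ E]
    [NormedAddCommGroup F] [NormedSpace ℝ F] [NormedAddCommGroup G] [NormedSpace ℝ G]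
    {S : E → F →L[ℝ] G} {S' : E →L[ℝ] F →L[ℝ] G} {u : E} (h : HasFDerivAt S S' u) (y : F) :
    HasFDerivAt (fun w => S w y) (S'.flip y) u :=
  (ContinuousLinearMap.apply ℝ G y).hasFDerivAt.comp u h

/-- The Koszul argument: the Christoffel symbols of a `V`-valued frame with vanishing torsion are
determined by its Gram matrix. -/
theorem inner_fderiv_eq_of_gram_eq {T T' : E → E →L[ℝ] V} {u : E}
    (hT : DifferentiableAt ℝ T u) (hT' : DifferentiableAt ℝ T' u)
    (hg : ∀ᶠ w in 𝓝 u, ∀ x y, ⟪T' w x, T' w y⟫ = ⟪T w x, T w y⟫)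
    (htor : ∀ x y z, ⟪fderiv ℝ T u x y - fderiv ℝ T u y x, T u z⟫ = 0)
    (htor' : ∀ x y z, ⟪fderiv ℝ T' u x y - fderiv ℝ T' u y x, T' u z⟫ = 0) (x y z : E) :
    ⟪fderiv ℝ T' u x y, T' u z⟫ = ⟪fderiv ℝ T u x y, T u z⟫ := by
  have hd : ∀ {S : E → E →L[ℝ] V}, DifferentiableAt ℝ S u → ∀ x y z,
      fderiv ℝ (fun w => ⟪S w y, S w z⟫) u x =
        ⟪S u y, fderiv ℝ S u x z⟫ + ⟪fderiv ℝ S u x y, S u z⟫ := by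
    intro S hS x y z
    have h1 : ∀ y, HasFDerivAt (fun w => S w y) ((fderiv ℝ S u).flip y) u := fun y =>
      hS.hasFDerivAt.clm_apply_vector y
    have := ((h1 y).inner ℝ (h1 z)).fderiv
    rw [this]
    simp
  have hc : ∀ x y z, ⟪T' u y, fderiv ℝ T' u x z⟫ + ⟪fderiv ℝ T' u x y, T' u z⟫ =
      ⟪T u y, fderiv ℝ T u x z⟫ + ⟪fderiv ℝ T u x y, T u z⟫ := by
    intro x y z
    rw [← hd hT, ← hd hT']
    congr 1
    apply Filter.EventuallyEq.fderiv_eq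
    filter_upwards [hg] with w hw using hw y z
  -- Torsion enters only through its products with the frame vectors, so a normal torsion is
  -- harmless. The Koszul formula then results from three permutations of the differentiated Gram
  -- identity.
  simp only [inner_sub_left, sub_eq_zero] at htor htor'
  simp only [real_inner_comm _ (T u _), real_inner_comm _ (T' u _)] at hc
  have a1 := hc x y z
  have a2 := hc y x z
  have a3 := hc z x y
  have t1 := htor x y z
  have t2 := htor x z y
  have t3 := htor y z x
  have s1 := htor' x y z
  have s2 := htor' x z y
  have s3 := htor' y z x
  have c1 := fun x y z => real_inner_comm (fderiv ℝ T u x y) (T u z)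
  have c2 := fun x y z => real_inner_comm (fderiv ℝ T' u x y) (T' u z)
  simp only [c1, c2] at *
  linarith

/-- The part of the Gauss equation determined by the Gram matrix. -/
theorem inner_fderiv_sub_eq_of_gram_eq {T T' : E → E →L[ℝ] V} {u : E}
    (hT : ContDiffAt ℝ 2 T u) (hT' : ContDiffAt ℝ 2 T' u)
    (hΓ : ∀ᶠ w in 𝓝 u, ∀ x y z, ⟪fderiv ℝ T' w x y, T' w z⟫ = ⟪fderiv ℝ T w x y, T w z⟫)
    (x y w z : E) :
    ⟪fderiv ℝ T' u x y, fderiv ℝ T' u w z⟫ - ⟪fderiv ℝ T' u w y, fderiv ℝ T' u x z⟫ =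
      ⟪fderiv ℝ T u x y, fderiv ℝ T u w z⟫ - ⟪fderiv ℝ T u w y, fderiv ℝ T u x z⟫ := by
  have hd : ∀ {S : E → E →L[ℝ] V}, ContDiffAt ℝ 2 S u → ∀ w x y z,
      fderiv ℝ (fun v => ⟪fderiv ℝ S v x y, S v z⟫) u w =
        ⟪fderiv ℝ S u x y, fderiv ℝ S u w z⟫ + ⟪fderiv ℝ (fderiv ℝ S) u w x y, S u z⟫ := by
    intro S hS w x y z
    have h1 : HasFDerivAt (fun w => S w z) ((fderiv ℝ S u).flip z) u :=
      (hS.differentiableAt (by norm_num)).hasFDerivAt.clm_apply_vector z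
    have h2 : HasFDerivAt (fun v => fderiv ℝ S v x y)
        (((fderiv ℝ (fderiv ℝ S) u).flip x).flip y) u :=
      (((hS.fderiv_right (m := 1) (by norm_num)).differentiableAt
        (by norm_num)).hasFDerivAt.clm_apply_vector x).clm_apply_vector y
    rw [(h2.inner ℝ h1).fderiv]
    simp
  have hsymm : ∀ {S : E → E →L[ℝ] V}, ContDiffAt ℝ 2 S u → ∀ w x,
      fderiv ℝ (fderiv ℝ S) u w x = fderiv ℝ (fderiv ℝ S) u x w := fun hS w x =>
    (hS.isSymmSndFDerivAt (by simp)).eq w x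
  have hc : ∀ w x y z, fderiv ℝ (fun v => ⟪fderiv ℝ T' v x y, T' v z⟫) u w =
      fderiv ℝ (fun v => ⟪fderiv ℝ T v x y, T v z⟫) u w := by
    intro w x y z
    congr 1
    apply Filter.EventuallyEq.fderiv_eq
    filter_upwards [hΓ] with v hv using hv x y z
  -- Antisymmetrizing in `w` and `x` removes the second derivatives of the frames, which are
  -- symmetric, and leaves the quadratic terms.
  have h1 := hc w x y z
  have h2 := hc x w y z
  rw [hd hT, hd hT'] at h1 h2
  rw [hsymm hT, hsymm hT'] at h1
  linarith

/-- Linear isometries intertwining two nondegenerate frames and their derivatives are locally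
constant. -/
theorem hasFDerivAt_zero_of_intertwine [FiniteDimensional ℝ E] [FiniteDimensional ℝ V]
    (hdim : Module.finrank ℝ V = Module.finrank ℝ E + 1)
    {T T' : E → E →L[ℝ] V} {Ψ : E → V →L[ℝ] V} {u : E} {N : V}
    (hT : ContDiffAt ℝ 2 T u) (hT' : ContDiffAt ℝ 2 T' u) (hinj : Function.Injective (T u))
    (hiso : ∀ᶠ w in 𝓝 u, ∀ v v', ⟪Ψ w v, Ψ w v'⟫ = ⟪v, v'⟫)
    (h0 : ∀ᶠ w in 𝓝 u, ∀ y, Ψ w (T w y) = T' w y)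
    (h1 : ∀ᶠ w in 𝓝 u, ∀ x y, Ψ w (fderiv ℝ T w x y) = fderiv ℝ T' w x y)
    (hN : ‖N‖ = 1) (hNT : ∀ y, ⟪N, T u y⟫ = 0) (a b : E) (hab : ⟪fderiv ℝ T u a b, N⟫ ≠ 0) :
    HasFDerivAt Ψ (0 : E →L[ℝ] V →L[ℝ] V) u := by
  -- Nothing is known about the regularity of `Ψ`, which is later chosen point by point. Adjoining
  -- to `T` the vector `fderiv ℝ T w a b`, whose normal component at `u` is nonzero, gives an
  -- invertible map near `u`. There `Ψ = S T' ∘ (S T)⁻¹`, hence `Ψ` is differentiable at `u`.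
  let S : (E → E →L[ℝ] V) → E → (E × ℝ) →L[ℝ] V := fun T w =>
    (T w).comp (ContinuousLinearMap.fst ℝ E ℝ) +
      (ContinuousLinearMap.snd ℝ E ℝ).smulRight (fderiv ℝ T w a b)
  have hSd : ∀ {T : E → E →L[ℝ] V}, ContDiffAt ℝ 2 T u → DifferentiableAt ℝ (S T) u := by
    intro T hT
    have d1 : DifferentiableAt ℝ T u := hT.differentiableAt (by norm_num)
    have d2 : DifferentiableAt ℝ (fun v => fderiv ℝ T v a b) u :=
      (((hT.fderiv_right (m := 1) (by norm_num)).differentiableAt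
        (by norm_num)).clm_apply (differentiableAt_const a)).clm_apply (differentiableAt_const b)
    exact (d1.clm_comp (differentiableAt_const _)).add
      (((ContinuousLinearMap.smulRightL ℝ (E × ℝ) V
        (ContinuousLinearMap.snd ℝ E ℝ)).differentiableAt).comp u d2)
  have hSinj : Function.Injective (S T u) := by
    rw [injective_iff_map_eq_zero]
    rintro ⟨y, t⟩ h
    have h' : T u y + t • fderiv ℝ T u a b = 0 := h
    have h2 := congrArg (fun v => ⟪v, N⟫) h'
    simp only [inner_add_left, real_inner_smul_left, inner_zero_left,
      real_inner_comm N (T u y), hNT, zero_add] at h2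
    have ht : t = 0 := (mul_eq_zero.1 h2).resolve_right hab
    rw [ht, zero_smul, add_zero] at h'
    rw [(injective_iff_map_eq_zero (T u)).1 hinj y h', ht]
    rfl
  let e : (E × ℝ) ≃L[ℝ] V := (LinearEquiv.ofInjectiveOfFinrankEq (S T u).toLinearMap hSinj
    (by rw [hdim, Module.finrank_prod, Module.finrank_self])).toContinuousLinearEquiv
  have he : (e : (E × ℝ) →L[ℝ] V) = S T u := by ext <;> rfl
  have hinv : DifferentiableAt ℝ (fun w => (S T w).inverse) u := by
    have hc : ContDiffAt ℝ 1 ContinuousLinearMap.inverse (S T u) := he ▸ contDiffAt_map_inverse e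
    exact (hc.differentiableAt (by norm_num)).comp u (hSd hT)
  have hnear : ∀ᶠ w in 𝓝 u, (S T w).IsInvertible := by
    have : {L : (E × ℝ) →L[ℝ] V | L.IsInvertible} ∈ 𝓝 (S T u) := by
      rw [← he]; exact e.nhds
    exact (hSd hT).continuousAt this
  have hΨd : DifferentiableAt ℝ Ψ u := by
    refine ((hSd hT').clm_comp hinv).congr_of_eventuallyEq ?_
    filter_upwards [hnear, h0, h1] with w hw hw0 hw1
    have : S T' w = (Ψ w).comp (S T w) := by
      ext y <;> simp [S, hw0, hw1]
    rw [this, ContinuousLinearMap.comp_assoc, hw.self_comp_inverse, ContinuousLinearMap.comp_id]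
  -- Derivative of the isometry identity: `DΨ` is skew relative to `Ψ`.
  have hK : ∀ x v v', ⟪Ψ u v, fderiv ℝ Ψ u x v'⟫ + ⟪fderiv ℝ Ψ u x v, Ψ u v'⟫ = 0 := by
    intro x v v'
    have e1 : ∀ v, HasFDerivAt (fun w => Ψ w v) ((fderiv ℝ Ψ u).flip v) u := fun v =>
      hΨd.hasFDerivAt.clm_apply_vector v
    have e2 := ((e1 v).inner ℝ (e1 v')).fderiv
    have e3 : fderiv ℝ (fun w => ⟪Ψ w v, Ψ w v'⟫) u = 0 := by
      have : (fun w => ⟪Ψ w v, Ψ w v'⟫) =ᶠ[𝓝 u] fun _ => ⟪v, v'⟫ := by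
        filter_upwards [hiso] with w hw using hw v v'
      rw [this.fderiv_eq]
      simp
    rw [e3] at e2
    have e4 := congrArg (fun L : E →L[ℝ] ℝ => L x) e2
    simpa using e4.symm
  -- Differentiating `Ψ T = T'` gives `(DΨ) T + Ψ (DT) = DT'`, and the last two terms cancel by
  -- `h1`.
  have hKT : ∀ x y, fderiv ℝ Ψ u x (T u y) = 0 := by
    intro x y
    have e1 := (hΨd.hasFDerivAt.clm_apply
      ((hT.differentiableAt (by norm_num)).hasFDerivAt.clm_apply_vector y)).fderiv
    have e2 := ((hT'.differentiableAt (by norm_num)).hasFDerivAt.clm_apply_vector y).fderiv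
    have e3 : (fun w => Ψ w (T w y)) =ᶠ[𝓝 u] fun w => T' w y := by
      filter_upwards [h0] with w hw using hw y
    rw [e3.fderiv_eq, e2] at e1
    have e4 := congrArg (fun L : E →L[ℝ] V => L x) e1
    simpa [h1.self_of_nhds x y] using e4
  have hzero : fderiv ℝ Ψ u = 0 := by
    ext x v
    -- By skewness, vanishing on the tangent space makes the image of `DΨ` orthogonal to `Ψ (T u)`.
    -- Skewness on the pair `N, N` then gives `hKN`, and `N` together with the range of `T u` spans
    -- `V`.
    have hk : ∀ v v', ⟪fderiv ℝ Ψ u x v, Ψ u (T u v')⟫ = 0 := fun v v' => by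
      have := hK x v (T u v')
      rwa [hKT, inner_zero_right, zero_add] at this
    have hΨinj : ∀ v, ‖Ψ u v‖ = ‖v‖ := fun v => by
      rw [@norm_eq_sqrt_real_inner V, hiso.self_of_nhds, ← norm_eq_sqrt_real_inner]
    have hKN : fderiv ℝ Ψ u x N = 0 := by
      refine eq_zero_of_inner_hyperplane (T := (Ψ u).comp (T u)) (N := Ψ u N) hdim ?_
        (by rw [hΨinj, hN]) (fun y => ?_) (fun y => hk _ y) ?_
      · rw [injective_iff_map_eq_zero]
        intro y hy
        apply (injective_iff_map_eq_zero (T u)).1 hinj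
        rw [← norm_eq_zero, ← hΨinj]
        exact norm_eq_zero.2 hy
      · exact (hiso.self_of_nhds _ _).trans (hNT y)
      · have := hK x N N
        rw [real_inner_comm] at this
        linarith
    have hmem : v - ⟪v, N⟫ • N ∈ LinearMap.range (T u).toLinearMap := by
      rw [← Submodule.orthogonal_orthogonal (LinearMap.range (T u).toLinearMap),
        Submodule.mem_orthogonal]
      intro w hw
      have hw' : w - ⟪w, N⟫ • N = 0 := by
        refine eq_zero_of_inner_hyperplane hdim hinj hN hNT (fun y => ?_) ?_
        · have hwy : ⟪w, T u y⟫ = 0 := (Submodule.mem_orthogonal' _ _).1 hw _ ⟨y, rfl⟩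
          rw [inner_sub_left, real_inner_smul_left, hNT, hwy]
          simp
        · rw [inner_sub_left, real_inner_smul_left, real_inner_self_eq_norm_sq, hN]
          ring
      rw [sub_eq_zero.1 hw', inner_sub_right, real_inner_smul_left, real_inner_smul_left,
        real_inner_smul_right, real_inner_self_eq_norm_sq, hN, real_inner_comm v N]
      ring
    obtain ⟨y, hy⟩ := hmem
    have hv : v = T u y + ⟪v, N⟫ • N := by
      rw [show T u y = _ from hy]; abel
    rw [hv, map_add, map_smul, hKT, hKN]
    simp
  rw [← hzero]
  exact hΨd.hasFDerivAt

/-- The local rigidity theorem: if a `V`-valued frame `T` is torsion-free up to its normal part and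
its second fundamental form has rank at least three, then every frame which is a differential and
has the same Gram matrix is obtained from `T` by a fixed linear isometry. -/
theorem exists_linearIsometry_of_gram_eq [FiniteDimensional ℝ E] [FiniteDimensional ℝ V]
    (hdim : Module.finrank ℝ V = Module.finrank ℝ E + 1)
    {T T' : E → E →L[ℝ] V} {N : E → V} {U : Set E} (hU : IsOpen U) (hUc : Convex ℝ U)
    (hT : ContDiffOn ℝ 2 T U) (hT' : ContDiffOn ℝ 2 T' U)
    (hinj : ∀ u ∈ U, Function.Injective (T u))
    (hg : ∀ u ∈ U, ∀ x y, ⟪T' u x, T' u y⟫ = ⟪T u x, T u y⟫)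
    (htor : ∀ u ∈ U, ∀ x y z, ⟪fderiv ℝ T u x y - fderiv ℝ T u y x, T u z⟫ = 0)
    (htor' : ∀ u ∈ U, ∀ x y, fderiv ℝ T' u x y = fderiv ℝ T' u y x)
    (hN : ∀ u ∈ U, ‖N u‖ = 1) (hNT : ∀ u ∈ U, ∀ y, ⟪N u, T u y⟫ = 0)
    (hrank : ∀ u ∈ U, ∃ a b : Fin 3 → E,
      ∀ i j, ⟪fderiv ℝ T u (a i) (b j), N u⟫ = if i = j then 1 else 0) :
    ∃ Ψ : V →ₗᵢ[ℝ] V, ∀ u ∈ U, ∀ y, Ψ (T u y) = T' u y := by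
  have hTa : ∀ u ∈ U, ContDiffAt ℝ 2 T u := fun u hu => hT.contDiffAt (hU.mem_nhds hu)
  have hTa' : ∀ u ∈ U, ContDiffAt ℝ 2 T' u := fun u hu => hT'.contDiffAt (hU.mem_nhds hu)
  have hΓ : ∀ u ∈ U, ∀ x y z, ⟪fderiv ℝ T' u x y, T' u z⟫ = ⟪fderiv ℝ T u x y, T u z⟫ :=
    fun u hu => inner_fderiv_eq_of_gram_eq ((hTa u hu).differentiableAt (by norm_num))
      ((hTa' u hu).differentiableAt (by norm_num))
      (by filter_upwards [hU.mem_nhds hu] with w hw using hg w hw) (htor u hu)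
      (fun x y z => by rw [htor' u hu, sub_self, inner_zero_left])
  have hex : ∀ u ∈ U, ∃ Ψ : V →ₗᵢ[ℝ] V, (∀ y, Ψ (T u y) = T' u y) ∧
      ∀ x y, Ψ (fderiv ℝ T u x y) = fderiv ℝ T' u x y := by
    intro u hu
    obtain ⟨a, b, hab⟩ := hrank u hu
    exact exists_linearIsometry_of_gauss hdim (D := fun x y => fderiv ℝ T u x y)
      (D' := fun x y => fderiv ℝ T' u x y) (hinj u hu) (hg u hu) (hN u hu) (hNT u hu) (hΓ u hu)
      (inner_fderiv_sub_eq_of_gram_eq (hTa u hu) (hTa' u hu)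
        (by filter_upwards [hU.mem_nhds hu] with w hw using hΓ w hw)) a b hab
  choose! Ψ hΨ0 hΨ1 using hex
  rcases U.eq_empty_or_nonempty with rfl | ⟨u₀, hu₀⟩
  · exact ⟨LinearIsometry.id, by simp⟩
  have hder : ∀ u ∈ U, HasFDerivAt (fun w => (Ψ w).toContinuousLinearMap)
      (0 : E →L[ℝ] V →L[ℝ] V) u := by
    intro u hu
    obtain ⟨a, b, hab⟩ := hrank u hu
    have hn := hU.mem_nhds hu
    refine hasFDerivAt_zero_of_intertwine hdim (hTa u hu) (hTa' u hu) (hinj u hu) ?_ ?_ ?_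
      (hN u hu) (hNT u hu) (a 0) (b 0) (by rw [hab]; simp)
    · exact .of_forall fun w v v' => (Ψ w).inner_map_map v v'
    · filter_upwards [hn] with w hw using hΨ0 w hw
    · filter_upwards [hn] with w hw using hΨ1 w hw
  refine ⟨Ψ u₀, fun u hu y => ?_⟩
  have hconst := hUc.is_const_of_fderivWithin_eq_zero (𝕜 := ℝ)
    (f := fun w => (Ψ w).toContinuousLinearMap)
    (fun w hw => (hder w hw).differentiableAt.differentiableWithinAt)
    (fun w hw => ((hder w hw).hasFDerivWithinAt).fderivWithin (hU.uniqueDiffWithinAt hw)) hu₀ hu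
  rw [← hΨ0 u hu]
  exact congrArg (fun L : V →L[ℝ] V => L (T u y)) hconst

end Local

/-! ### Gluing over a simply connected space -/

/-- On a simply connected space, local functions whose differences are locally constant can be
corrected by locally constant functions to a global one. -/
theorem exists_glue_of_locally_constant_sub {B V : Type*} [TopologicalSpace B]
    [SimplyConnectedSpace B] [LocallyPathConnectedSpace B] [AddCommGroup V]
    (W : B → Set B) (hW : ∀ i, IsOpen (W i)) (hmem : ∀ i, i ∈ W i) (h : B → B → V)
    (hloc : ∀ i j, ∀ x ∈ W i ∩ W j, ∀ᶠ y in 𝓝 x, h i y - h j y = h i x - h j x) :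
    ∃ G : B → V, ∀ i, ∀ x ∈ W i, ∀ᶠ y in 𝓝 x, G y - h i y = G x - h i x := by
  -- With discrete fibres, the locally constant transition functions `h i - h j` are continuous and
  -- the resulting bundle is a covering of `B`.
  let : TopologicalSpace V := ⊥
  have : DiscreteTopology V := ⟨rfl⟩
  let Z : FiberBundleCore B B V :=
    { baseSet := W
      isOpen_baseSet := hW
      indexAt := id
      mem_baseSet_at := hmem
      coordChange := fun i j x v => v + (h i x - h j x)
      coordChange_self := by simp
      continuousOn_coordChange := by
        rintro i j ⟨x, v⟩ ⟨hx, -⟩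
        have hc : Continuous fun p : B × V => p.2 + (h i x - h j x) :=
          (continuous_of_discreteTopology (f := fun v : V => v + (h i x - h j x))).comp
            continuous_snd
        refine (hc.continuousAt.congr ?_).continuousWithinAt
        have := (continuous_fst (X := B) (Y := V)).continuousAt (x := (x, v)) |>.eventually
          (hloc i j x hx)
        filter_upwards [this] with p hp
        rw [hp]
      coordChange_comp := by
        intros
        abel }
  have cov : IsCoveringMap (π V Z.Fiber) := FiberBundle.isCoveringMap
  obtain ⟨b₀⟩ : Nonempty B := inferInstance
  -- Simple connectedness lifts the identity of `B`, which gives a global section of the covering.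
  obtain ⟨F, ⟨-, hF⟩, -⟩ := cov.existsUnique_continuousMap_lifts (ContinuousMap.id B) b₀
    (⟨b₀, (0 : V)⟩ : Z.TotalSpace) rfl
  have hF1 : ∀ x, (F x).1 = x := fun x => congrFun hF x
  let v : B → V := fun x => (F x).2
  have hv : ∀ i x, (Z.localTriv i (F x)).2 = v x + (h x x - h i x) := by
    intro i x
    change v x + (h (F x).1 (F x).1 - h i (F x).1) = _
    rw [hF1]
  refine ⟨fun x => h x x + v x, fun i x hx => ?_⟩
  have hcont : ContinuousAt (fun y => (Z.localTriv i (F y)).2) x := by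
    refine continuous_snd.continuousAt.comp (ContinuousAt.comp ?_ F.continuous.continuousAt)
    refine (Z.localTriv i).continuousAt ?_
    rw [(Z.localTriv i).mem_source]
    change (F x).1 ∈ W i
    rwa [hF1]
  have hev : ∀ᶠ y in 𝓝 x, (Z.localTriv i (F y)).2 = (Z.localTriv i (F x)).2 :=
    hcont.eventually (p := fun v => v = (Z.localTriv i (F x)).2)
      (by rw [nhds_discrete]; exact Filter.eventually_pure.2 rfl)
  filter_upwards [hev] with y hy
  rw [hv, hv] at hy
  rw [show h y y + v y - h i y = v y + (h y y - h i y) by abel, hy]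
  abel

/-! ### One-forms in charts and the Poincaré lemma -/

section Chart

variable {n : ℕ} {M : Type*} [TopologicalSpace M] [ChartedSpace (EuclideanSpace ℝ (Fin n)) M]
  [IsManifold (𝓡 n) ∞ M] {V : Type*} [NormedAddCommGroup V] [NormedSpace ℝ V]

/-- The coordinate frame at `p` of the chart at `p₀`. -/
noncomputable def frame (p₀ p : M) : EuclideanSpace ℝ (Fin n) →L[ℝ] TangentSpace (𝓡 n) p :=
  (trivializationAt (EuclideanSpace ℝ (Fin n)) (fun q : M => TangentSpace (𝓡 n) q) p₀).symmL ℝ p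

/-- The coordinate expression of a vector-valued 1-form in the chart at `p₀`. -/
noncomputable def pullForm (p₀ : M) (η : Π p : M, TangentSpace (𝓡 n) p →L[ℝ] V) (u : EuclideanSpace ℝ (Fin n)) :
    EuclideanSpace ℝ (Fin n) →L[ℝ] V :=
  η ((extChartAt (𝓡 n) p₀).symm u) ∘L frame p₀ ((extChartAt (𝓡 n) p₀).symm u)

/-- Identifies the frame of the bundle trivialization with the derivative of the inverse chart, so
that `pullForm` is an honest pullback. -/
theorem frame_eq_mfderiv {p₀ p : M} (hp : p ∈ (extChartAt (𝓡 n) p₀).source) :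
    frame p₀ p = mfderiv 𝓘(ℝ, EuclideanSpace ℝ (Fin n)) (𝓡 n) (extChartAt (𝓡 n) p₀).symm
      (extChartAt (𝓡 n) p₀ p) := by
  have : IsManifold (𝓡 n) 1 M := IsManifold.of_le (n := ∞) (by norm_cast)
  have h := TangentBundle.symmL_trivializationAt (I := 𝓡 n) (𝕜 := ℝ) (x₀ := p₀) (x := p)
    (by rwa [← extChartAt_source (𝓡 n)])
  rw [ModelWithCorners.range_eq_univ, mfderivWithin_univ] at h
  exact h

theorem frame_bijective {p₀ p : M} (hp : p ∈ (extChartAt (𝓡 n) p₀).source) :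
    Function.Bijective (frame (n := n) p₀ p) := by
  have : IsManifold (𝓡 n) 1 M := IsManifold.of_le (n := ∞) (by norm_cast)
  have hp' : p ∈ (trivializationAt (EuclideanSpace ℝ (Fin n))
      (fun q : M => TangentSpace (𝓡 n) q) p₀).baseSet := by
    rw [TangentBundle.trivializationAt_baseSet]
    rwa [← extChartAt_source (𝓡 n)]
  exact ⟨Function.LeftInverse.injective
      (Trivialization.continuousLinearMapAt_symmL (R := ℝ) _ hp'),
    Function.RightInverse.surjective (Trivialization.symmL_continuousLinearMapAt (R := ℝ) _ hp')⟩

omit [IsManifold (𝓡 n) ∞ M] in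
theorem isOpen_target (p₀ : M) : IsOpen (extChartAt (𝓡 n) p₀).target :=
  isOpen_extChartAt_target p₀

/-- The chain rule for the inverse chart. It turns differentials on `M` into Fréchet derivatives on
the chart target. -/
theorem hasFDerivAt_comp_extChartAt_symm {p₀ : M} {G : M → V} {u : EuclideanSpace ℝ (Fin n)}
    (hu : u ∈ (extChartAt (𝓡 n) p₀).target)
    (hG : MDifferentiableAt (𝓡 n) 𝓘(ℝ, V) G ((extChartAt (𝓡 n) p₀).symm u)) :
    HasFDerivAt (G ∘ (extChartAt (𝓡 n) p₀).symm) (pullForm p₀ (mvfderiv (𝓡 n) G) u) u := by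
  have : IsManifold (𝓡 n) 1 M := IsManifold.of_le (n := ∞) (by norm_cast)
  have hs : MDifferentiableAt 𝓘(ℝ, EuclideanSpace ℝ (Fin n)) (𝓡 n) (extChartAt (𝓡 n) p₀).symm u := by
    have := mdifferentiableWithinAt_extChartAt_symm (I := 𝓡 n) (x := p₀) hu
    rwa [ModelWithCorners.range_eq_univ, mdifferentiableWithinAt_univ] at this
  have h := (hG.hasMFDerivAt.comp u hs.hasMFDerivAt).hasFDerivAt
  have hf := frame_eq_mfderiv (p₀ := p₀) ((extChartAt (𝓡 n) p₀).map_target hu)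
  rw [(extChartAt (𝓡 n) p₀).right_inv hu] at hf
  rw [pullForm, hf]
  exact h

theorem mdifferentiableAt_comp_extChartAt {p₀ p : M} (hp : p ∈ (extChartAt (𝓡 n) p₀).source)
    {F : EuclideanSpace ℝ (Fin n) → V} (hF : DifferentiableAt ℝ F (extChartAt (𝓡 n) p₀ p)) :
    MDifferentiableAt (𝓡 n) 𝓘(ℝ, V) (F ∘ extChartAt (𝓡 n) p₀) p := by
  have : IsManifold (𝓡 n) 1 M := IsManifold.of_le (n := ∞) (by norm_cast)
  exact hF.mdifferentiableAt.comp p (mdifferentiableAt_extChartAt (by rwa [← extChartAt_source (𝓡 n)]))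

/-- The converse passage: a primitive found in coordinates is one on the manifold, since the frame
is surjective on the tangent space. -/
theorem mvfderiv_comp_extChartAt {p₀ p : M} (hp : p ∈ (extChartAt (𝓡 n) p₀).source)
    {F : EuclideanSpace ℝ (Fin n) → V} {η : Π p : M, TangentSpace (𝓡 n) p →L[ℝ] V}
    (hF : HasFDerivAt F (pullForm p₀ η (extChartAt (𝓡 n) p₀ p)) (extChartAt (𝓡 n) p₀ p)) :
    mvfderiv (𝓡 n) (F ∘ extChartAt (𝓡 n) p₀) p = η p := by
  have hu := (extChartAt (𝓡 n) p₀).map_source hp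
  have hinv := (extChartAt (𝓡 n) p₀).left_inv hp
  have hd := mdifferentiableAt_comp_extChartAt hp hF.differentiableAt
  have h1 := hasFDerivAt_comp_extChartAt_symm (G := F ∘ extChartAt (𝓡 n) p₀) hu (by rwa [hinv])
  have h2 : (F ∘ extChartAt (𝓡 n) p₀) ∘ (extChartAt (𝓡 n) p₀).symm
      =ᶠ[𝓝 (extChartAt (𝓡 n) p₀ p)] F := by
    filter_upwards [(isOpen_target p₀).mem_nhds hu] with w hw
    simp only [Function.comp_apply, (extChartAt (𝓡 n) p₀).right_inv hw]
  have h3 := (h2.hasFDerivAt_iff.1 h1).unique hF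
  ext v
  rw [pullForm, pullForm, hinv] at h3
  obtain ⟨x, rfl⟩ := (frame_bijective hp).2 v
  exact congrArg (fun L : EuclideanSpace ℝ (Fin n) →L[ℝ] V => L x) h3

theorem contDiffOn_comp_extChartAt_symm {G : M → V} (hG : ContMDiff (𝓡 n) 𝓘(ℝ, V) ∞ G) (p₀ : M) :
    ContDiffOn ℝ ∞ (G ∘ (extChartAt (𝓡 n) p₀).symm) (extChartAt (𝓡 n) p₀).target :=
  (hG.comp_contMDiffOn (contMDiffOn_extChartAt_symm p₀)).contDiffOn

theorem contDiffOn_pullForm_mvfderiv {G : M → V} (hG : ContMDiff (𝓡 n) 𝓘(ℝ, V) ∞ G) (p₀ : M) :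
    ContDiffOn ℝ ∞ (pullForm p₀ (mvfderiv (𝓡 n) G)) (extChartAt (𝓡 n) p₀).target := by
  refine ((contDiffOn_comp_extChartAt_symm hG p₀).fderiv_of_isOpen (m := ∞) (isOpen_target p₀)
    (by simp)).congr fun u hu => ?_
  exact ((hasFDerivAt_comp_extChartAt_symm hu
    ((hG _).mdifferentiableAt (by simp))).fderiv).symm

/-- The form is itself a derivative in the chart, so this is the symmetry of second derivatives,
that is, `d(dG) = 0`. -/
theorem fderiv_pullForm_mvfderiv_symm {G : M → V} (hG : ContMDiff (𝓡 n) 𝓘(ℝ, V) ∞ G) {p₀ : M}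
    {u : EuclideanSpace ℝ (Fin n)} (hu : u ∈ (extChartAt (𝓡 n) p₀).target)
    (x y : EuclideanSpace ℝ (Fin n)) :
    fderiv ℝ (pullForm p₀ (mvfderiv (𝓡 n) G)) u x y =
      fderiv ℝ (pullForm p₀ (mvfderiv (𝓡 n) G)) u y x := by
  have h : pullForm p₀ (mvfderiv (𝓡 n) G) =ᶠ[𝓝 u]
      fderiv ℝ (G ∘ (extChartAt (𝓡 n) p₀).symm) := by
    filter_upwards [(isOpen_target p₀).mem_nhds hu] with w hw
    exact (hasFDerivAt_comp_extChartAt_symm hw ((hG _).mdifferentiableAt (by simp))).fderiv.symm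
  rw [h.fderiv_eq]
  exact ((((contDiffOn_comp_extChartAt_symm hG p₀).contDiffAt
    ((isOpen_target p₀).mem_nhds hu)).isSymmSndFDerivAt
      (by simpa using (by norm_cast : (2 : WithTop ℕ∞) ≤ ∞)))).eq x y

theorem contMDiff_of_pullForm {G : M → V} (hd : ∀ p, MDifferentiableAt (𝓡 n) 𝓘(ℝ, V) G p)
    (h : ∀ p₀, ContDiffOn ℝ ∞ (pullForm p₀ (mvfderiv (𝓡 n) G)) (extChartAt (𝓡 n) p₀).target) :
    ContMDiff (𝓡 n) 𝓘(ℝ, V) ∞ G := by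
  intro p₀
  have h1 : ContDiffOn ℝ ∞ (G ∘ (extChartAt (𝓡 n) p₀).symm) (extChartAt (𝓡 n) p₀).target := by
    have hF : ∀ u ∈ (extChartAt (𝓡 n) p₀).target, HasFDerivAt
        (G ∘ (extChartAt (𝓡 n) p₀).symm) (pullForm p₀ (mvfderiv (𝓡 n) G) u) u :=
      fun u hu => hasFDerivAt_comp_extChartAt_symm hu (hd _)
    rw [contDiffOn_infty_iff_fderiv_of_isOpen (isOpen_target p₀)]
    exact ⟨fun u hu => (hF u hu).differentiableAt.differentiableWithinAt,
      (h p₀).congr fun u hu => (hF u hu).fderiv⟩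
  have h2 : ContMDiffAt (𝓡 n) 𝓘(ℝ, V) ∞
      ((G ∘ (extChartAt (𝓡 n) p₀).symm) ∘ extChartAt (𝓡 n) p₀) p₀ :=
    ((h1.contDiffAt ((isOpen_target p₀).mem_nhds
      (mem_extChartAt_target p₀))).contMDiffAt).comp p₀ contMDiffAt_extChartAt
  refine h2.congr_of_eventuallyEq ?_
  filter_upwards [extChartAt_source_mem_nhds (I := 𝓡 n) p₀] with p hp
  simp only [Function.comp_apply, (extChartAt (𝓡 n) p₀).left_inv hp]

omit [IsManifold (𝓡 n) ∞ M] in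
theorem mvfderiv_congr {G H : M → V} {p : M} (h : G =ᶠ[𝓝 p] H) :
    mvfderiv (𝓡 n) G p = mvfderiv (𝓡 n) H p := by
  have := h.mfderiv_eq (I := 𝓡 n) (I' := 𝓘(ℝ, V))
  exact this

/-- A function on a manifold with vanishing differential on an open set is locally constant. -/
theorem eventually_eq_of_mvfderiv_eq_zero {G : M → V} {W : Set M} (hW : IsOpen W)
    (hd : ∀ p ∈ W, MDifferentiableAt (𝓡 n) 𝓘(ℝ, V) G p) (h : ∀ p ∈ W, mvfderiv (𝓡 n) G p = 0)
    {p : M} (hp : p ∈ W) : ∀ᶠ q in 𝓝 p, G q = G p := by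
  have hopen : IsOpen ((extChartAt (𝓡 n) p).target ∩ (extChartAt (𝓡 n) p).symm ⁻¹' W) :=
    (continuousOn_extChartAt_symm p).isOpen_inter_preimage (isOpen_target p) hW
  obtain ⟨r, hr, hball⟩ := Metric.isOpen_iff.1 hopen (extChartAt (𝓡 n) p p)
    ⟨mem_extChartAt_target p, by simpa using hp⟩
  have hnear : ∀ᶠ q in 𝓝 p, extChartAt (𝓡 n) p q ∈ Metric.ball (extChartAt (𝓡 n) p p) r :=
    (continuousAt_extChartAt p).eventually (Metric.ball_mem_nhds _ hr)
  filter_upwards [hnear, extChartAt_source_mem_nhds (I := 𝓡 n) p] with q hq hqs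
  have hF : ∀ u ∈ Metric.ball (extChartAt (𝓡 n) p p) r, HasFDerivAt
      (G ∘ (extChartAt (𝓡 n) p).symm) (0 : EuclideanSpace ℝ (Fin n) →L[ℝ] V) u := by
    intro u hu
    have h1 := hasFDerivAt_comp_extChartAt_symm (hball hu).1 (hd _ (hball hu).2)
    rw [pullForm, h _ (hball hu).2, ContinuousLinearMap.zero_comp] at h1
    exact h1
  have hc := (convex_ball _ r).is_const_of_fderivWithin_eq_zero (𝕜 := ℝ)
    (fun u hu => (hF u hu).differentiableAt.differentiableWithinAt)
    (fun u hu => ((hF u hu).hasFDerivWithinAt).fderivWithin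
      (Metric.isOpen_ball.uniqueDiffWithinAt hu)) hq (Metric.mem_ball_self hr)
  simpa only [Function.comp_apply, (extChartAt (𝓡 n) p).left_inv hqs,
    extChartAt_to_inv] using hc

/-- Two functions with the same differential on a connected manifold differ by a constant. -/
theorem eq_add_const_of_mvfderiv_eq [PreconnectedSpace M] {G H : M → V}
    (hG : ∀ p, MDifferentiableAt (𝓡 n) 𝓘(ℝ, V) G p) (hH : ∀ p, MDifferentiableAt (𝓡 n) 𝓘(ℝ, V) H p)
    (h : ∀ p, mvfderiv (𝓡 n) G p = mvfderiv (𝓡 n) H p) (p q : M) : G p - H p = G q - H q := by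
  have hlc : IsLocallyConstant (G - H) := by
    rw [IsLocallyConstant.iff_eventually_eq]
    intro p
    refine eventually_eq_of_mvfderiv_eq_zero isOpen_univ
      (fun q _ => (hG q).sub (hH q)) (fun q _ => ?_) (Set.mem_univ p)
    rw [mvfderiv_sub (hG q) (hH q), h, sub_self]
  exact hlc.apply_eq_of_preconnectedSpace p q

/-- The Poincaré lemma: a closed vector-valued 1-form on a simply connected manifold is exact. -/
theorem exists_mvfderiv_eq_of_closed [CompleteSpace V] [SimplyConnectedSpace M]
    (η : Π p : M, TangentSpace (𝓡 n) p →L[ℝ] V)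
    (hη : ∀ p₀, ContDiffOn ℝ ∞ (pullForm p₀ η) (extChartAt (𝓡 n) p₀).target)
    (hclosed : ∀ p₀, ∀ᶠ u in 𝓝 (extChartAt (𝓡 n) p₀ p₀), ∀ x y,
      fderiv ℝ (pullForm p₀ η) u x y = fderiv ℝ (pullForm p₀ η) u y x) :
    ∃ G : M → V, ContMDiff (𝓡 n) 𝓘(ℝ, V) ∞ G ∧ ∀ p, mvfderiv (𝓡 n) G p = η p := by
  have hprim : ∀ p₀ : M, ∃ (W : Set M) (g : M → V), IsOpen W ∧ p₀ ∈ W ∧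
      ∀ p ∈ W, MDifferentiableAt (𝓡 n) 𝓘(ℝ, V) g p ∧ mvfderiv (𝓡 n) g p = η p := by
    intro p₀
    -- Closedness is assumed only near the centre of each chart, so the Euclidean Poincaré lemma is
    -- applied on a small ball there.
    obtain ⟨r, hr, hball⟩ := Metric.mem_nhds_iff.1 (Filter.inter_mem (hclosed p₀)
      ((isOpen_target p₀).mem_nhds (mem_extChartAt_target p₀)))
    obtain ⟨F, hF⟩ := (convex_ball (extChartAt (𝓡 n) p₀ p₀) r).exists_forall_hasFDerivAt_of_fderiv_symmetric
      Metric.isOpen_ball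
      (((hη p₀).mono fun u hu => (hball hu).2).differentiableOn (by simp))
      (fun u hu => (hball hu).1)
    refine ⟨(extChartAt (𝓡 n) p₀).source ∩ extChartAt (𝓡 n) p₀ ⁻¹' Metric.ball _ r,
      F ∘ extChartAt (𝓡 n) p₀, (continuousOn_extChartAt p₀).isOpen_inter_preimage
        (isOpen_extChartAt_source p₀) Metric.isOpen_ball,
      ⟨mem_extChartAt_source p₀, Metric.mem_ball_self hr⟩, fun p hp => ?_⟩
    exact ⟨mdifferentiableAt_comp_extChartAt hp.1 (hF _ hp.2).differentiableAt,
      mvfderiv_comp_extChartAt hp.1 (hF _ hp.2)⟩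
  choose W g hW hmem hg using hprim
  have : LocallyPathConnectedSpace M :=
    ChartedSpace.locallyPathConnectedSpace (EuclideanSpace ℝ (Fin n)) M
  -- Two local primitives have equal differentials on their overlap, so their difference is locally
  -- constant.
  obtain ⟨G, hG⟩ := exists_glue_of_locally_constant_sub W hW hmem g (fun i j x hx => by
    refine eventually_eq_of_mvfderiv_eq_zero (G := g i - g j) ((hW i).inter (hW j))
      (fun q hq => ((hg i q hq.1).1).sub (hg j q hq.2).1) (fun q hq => ?_) hx
    rw [mvfderiv_sub (hg i q hq.1).1 (hg j q hq.2).1, (hg i q hq.1).2, (hg j q hq.2).2, sub_self])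
  have hGeq : ∀ p, G =ᶠ[𝓝 p] fun q => g p q + (G p - g p p) := by
    intro p
    filter_upwards [hG p p (hmem p)] with q hq
    rw [← hq]
    abel
  have hGd : ∀ p, MDifferentiableAt (𝓡 n) 𝓘(ℝ, V) G p := fun p =>
    (((hg p p (hmem p)).1).add (mdifferentiableAt_const (c := G p - g p p))).congr_of_eventuallyEq
      (hGeq p)
  have hGη : ∀ p, mvfderiv (𝓡 n) G p = η p := by
    intro p
    have h1 : mvfderiv (𝓡 n) G p = mvfderiv (𝓡 n) (fun q => g p q + (G p - g p p)) p :=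
      mvfderiv_congr (hGeq p)
    rw [h1, ← (hg p p (hmem p)).2]
    exact (mvfderiv_add (hg p p (hmem p)).1 mdifferentiableAt_const).trans
      (by rw [mvfderiv_const, add_zero])
  refine ⟨G, contMDiff_of_pullForm hGd fun p₀ => ?_, hGη⟩
  rw [show mvfderiv (𝓡 n) G = η from funext hGη]
  exact hη p₀

end Chart

/-! ### Vector fields and Lie brackets in coordinates -/

section Fields

variable {n : ℕ} {M : Type*} [TopologicalSpace M] [ChartedSpace (EuclideanSpace ℝ (Fin n)) M]
  [IsManifold (𝓡 n) ∞ M] {V : Type*} [NormedAddCommGroup V] [NormedSpace ℝ V]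

theorem mem_baseSet_of_mem_source {p₀ p : M} (hp : p ∈ (extChartAt (𝓡 n) p₀).source) :
    p ∈ (trivializationAt (EuclideanSpace ℝ (Fin n))
      (fun q : M => TangentSpace (𝓡 n) q) p₀).baseSet := by
  have : IsManifold (𝓡 n) 1 M := IsManifold.of_le (n := ∞) (by norm_cast)
  rw [TangentBundle.trivializationAt_baseSet]
  rwa [← extChartAt_source (𝓡 n)]

/-- The components of a vector field in the coordinate frame of the chart at `p₀`. -/
noncomputable def coord (p₀ : M) (X : Π p : M, TangentSpace (𝓡 n) p) (p : M) :
    EuclideanSpace ℝ (Fin n) :=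
  (trivializationAt (EuclideanSpace ℝ (Fin n)) (fun q : M => TangentSpace (𝓡 n) q) p₀
    (TotalSpace.mk' (EuclideanSpace ℝ (Fin n)) p (X p))).2

theorem frame_coord {p₀ p : M} (hp : p ∈ (extChartAt (𝓡 n) p₀).source)
    (X : Π p : M, TangentSpace (𝓡 n) p) : frame p₀ p (coord p₀ X p) = X p := by
  have h := Trivialization.symmL_continuousLinearMapAt (R := ℝ) _
    (mem_baseSet_of_mem_source hp) (X p)
  rw [Trivialization.continuousLinearMapAt_apply,
    Trivialization.coe_linearMapAt_of_mem _ (mem_baseSet_of_mem_source hp)] at h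
  exact h

theorem coord_of_eq_frame {p₀ p : M} (hp : p ∈ (extChartAt (𝓡 n) p₀).source)
    {X : Π p : M, TangentSpace (𝓡 n) p} {x : EuclideanSpace ℝ (Fin n)} (h : X p = frame p₀ p x) :
    coord p₀ X p = x :=
  (frame_bijective hp).1 (by rw [frame_coord hp, h])

theorem diffAt_iff_coord {p₀ p : M} (hp : p ∈ (extChartAt (𝓡 n) p₀).source)
    (X : Π p : M, TangentSpace (𝓡 n) p) : DiffAt X p ↔
      MDifferentiableAt (𝓡 n) 𝓘(ℝ, EuclideanSpace ℝ (Fin n)) (coord p₀ X) p := by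
  have : IsManifold (𝓡 n) 1 M := IsManifold.of_le (n := ∞) (by norm_cast)
  exact Trivialization.mdifferentiableAt_section_iff (𝓡 n) _ X (mem_baseSet_of_mem_source hp)

theorem contMDiffAt_iff_coord {p₀ p : M} (hp : p ∈ (extChartAt (𝓡 n) p₀).source)
    (X : Π p : M, TangentSpace (𝓡 n) p) :
    ContMDiffAt (𝓡 n) (𝓡 n).tangent ∞
      (fun q => TotalSpace.mk' (EuclideanSpace ℝ (Fin n)) q (X q)) p ↔
      ContMDiffAt (𝓡 n) 𝓘(ℝ, EuclideanSpace ℝ (Fin n)) ∞ (coord p₀ X) p :=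
  Trivialization.contMDiffAt_section_iff _ (mem_baseSet_of_mem_source hp)

theorem contMDiffAt_frame {p₀ p : M} (hp : p ∈ (extChartAt (𝓡 n) p₀).source)
    (x : EuclideanSpace ℝ (Fin n)) :
    ContMDiffAt (𝓡 n) (𝓡 n).tangent ∞
      (fun q => TotalSpace.mk' (EuclideanSpace ℝ (Fin n)) q (frame p₀ q x)) p := by
  rw [contMDiffAt_iff_coord hp]
  refine (contMDiffAt_const (c := x)).congr_of_eventuallyEq ?_
  filter_upwards [(isOpen_extChartAt_source p₀).mem_nhds hp] with q hq
  exact coord_of_eq_frame hq rfl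

theorem form_eq_pullForm_coord {p₀ p : M} (hp : p ∈ (extChartAt (𝓡 n) p₀).source)
    (η : Π p : M, TangentSpace (𝓡 n) p →L[ℝ] V) (X : Π p : M, TangentSpace (𝓡 n) p) :
    η p (X p) = pullForm p₀ η (extChartAt (𝓡 n) p₀ p) (coord p₀ X p) := by
  rw [pullForm, (extChartAt (𝓡 n) p₀).left_inv hp, ContinuousLinearMap.comp_apply, frame_coord hp]

theorem mdifferentiableAt_mvfderiv_apply {G : M → V} (hG : ContMDiff (𝓡 n) 𝓘(ℝ, V) ∞ G)
    {X : Π p : M, TangentSpace (𝓡 n) p} {p : M} (hX : DiffAt X p) :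
    MDifferentiableAt (𝓡 n) 𝓘(ℝ, V) (fun q => mvfderiv (𝓡 n) G q (X q)) p := by
  have h1 : MDifferentiableAt (𝓡 n) 𝓘(ℝ, EuclideanSpace ℝ (Fin n) →L[ℝ] V)
      (pullForm p (mvfderiv (𝓡 n) G) ∘ extChartAt (𝓡 n) p) p :=
    mdifferentiableAt_comp_extChartAt (mem_extChartAt_source p)
      (((contDiffOn_pullForm_mvfderiv hG p).contDiffAt ((isOpen_target p).mem_nhds
        (mem_extChartAt_target p))).differentiableAt (by simp))
  refine (h1.clm_apply ((diffAt_iff_coord (mem_extChartAt_source p) X).1 hX)).congr_of_eventuallyEq ?_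
  filter_upwards [extChartAt_source_mem_nhds (I := 𝓡 n) p] with q hq
  exact form_eq_pullForm_coord hq _ X

theorem contMDiffAt_mvfderiv_apply {G : M → V} (hG : ContMDiff (𝓡 n) 𝓘(ℝ, V) ∞ G)
    {X : Π p : M, TangentSpace (𝓡 n) p} {p : M}
    (hX : ContMDiffAt (𝓡 n) (𝓡 n).tangent ∞
      (fun q => TotalSpace.mk' (EuclideanSpace ℝ (Fin n)) q (X q)) p) :
    ContMDiffAt (𝓡 n) 𝓘(ℝ, V) ∞ (fun q => mvfderiv (𝓡 n) G q (X q)) p := by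
  have h1 : ContMDiffAt (𝓡 n) 𝓘(ℝ, EuclideanSpace ℝ (Fin n) →L[ℝ] V) ∞
      (pullForm p (mvfderiv (𝓡 n) G) ∘ extChartAt (𝓡 n) p) p :=
    (((contDiffOn_pullForm_mvfderiv hG p).contDiffAt ((isOpen_target p).mem_nhds
        (mem_extChartAt_target p))).contMDiffAt).comp p contMDiffAt_extChartAt
  refine (h1.clm_apply
    ((contMDiffAt_iff_coord (mem_extChartAt_source p) X).1 hX)).congr_of_eventuallyEq ?_
  filter_upwards [extChartAt_source_mem_nhds (I := 𝓡 n) p] with q hq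
  exact form_eq_pullForm_coord hq _ X

/-- A 1-form is smooth in coordinates if its values on coordinate frames are smooth. -/
theorem contDiffOn_pullForm {η : Π p : M, TangentSpace (𝓡 n) p →L[ℝ] V} {p₀ : M}
    (h : ∀ x, ContMDiffOn (𝓡 n) 𝓘(ℝ, V) ∞ (fun q => η q (frame p₀ q x))
      (extChartAt (𝓡 n) p₀).source) :
    ContDiffOn ℝ ∞ (pullForm p₀ η) (extChartAt (𝓡 n) p₀).target := by
  rw [contDiffOn_clm_apply]
  intro x
  exact ((h x).comp (contMDiffOn_extChartAt_symm p₀)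
    fun u hu => (extChartAt (𝓡 n) p₀).map_target hu).contDiffOn

theorem contMDiffAt_tensor_apply {Q : Π p : M, TangentSpace (𝓡 n) p →L[ℝ] TangentSpace (𝓡 n) p}
    (hQ : SmoothTensor Q) {X : Π p : M, TangentSpace (𝓡 n) p} {p : M}
    (hX : ContMDiffAt (𝓡 n) (𝓡 n).tangent ∞
      (fun q => TotalSpace.mk' (EuclideanSpace ℝ (Fin n)) q (X q)) p) :
    ContMDiffAt (𝓡 n) (𝓡 n).tangent ∞
      (fun q => TotalSpace.mk' (EuclideanSpace ℝ (Fin n)) q (Q q (X q))) p :=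
  ContMDiffAt.clm_bundle_apply (b := fun q : M => q) (hQ p) hX

theorem contDiffOn_pullForm_mvfderiv_comp {G : M → V} (hG : ContMDiff (𝓡 n) 𝓘(ℝ, V) ∞ G)
    {Q : Π p : M, TangentSpace (𝓡 n) p →L[ℝ] TangentSpace (𝓡 n) p} (hQ : SmoothTensor Q) (p₀ : M) :
    ContDiffOn ℝ ∞ (pullForm p₀ (fun p => mvfderiv (𝓡 n) G p ∘L Q p))
      (extChartAt (𝓡 n) p₀).target :=
  contDiffOn_pullForm fun x _ hq =>
    (contMDiffAt_mvfderiv_apply hG (contMDiffAt_tensor_apply hQ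
      (contMDiffAt_frame hq x))).contMDiffWithinAt

/-- Coordinate vector fields have global smooth extensions from a common neighborhood. -/
theorem exists_smoothField_eq_frame [T2Space M] (p₀ : M) :
    ∃ W ∈ 𝓝 p₀, ∀ x : EuclideanSpace ℝ (Fin n), ∃ X : Π p : M, TangentSpace (𝓡 n) p,
      SmoothField X ∧ ∀ p ∈ W, X p = frame p₀ p x := by
  -- `IsCodazzi` tests only globally smooth fields, so the coordinate fields are cut off by a bump
  -- function. Its neighborhood of value 1 serves all `x` at once.
  let ψ : SmoothBumpFunction (𝓡 n) p₀ := Classical.choice inferInstance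
  refine ⟨{p | ψ p = 1}, ψ.eventuallyEq_one, fun x => ⟨fun p => ψ p • frame p₀ p x, ?_, ?_⟩⟩
  · intro p
    by_cases hp : p ∈ tsupport ψ
    · have hs : p ∈ (extChartAt (𝓡 n) p₀).source := ψ.tsupport_subset_extChartAt_source hp
      rw [contMDiffAt_iff_coord hs]
      have h1 : ContMDiffAt (𝓡 n) 𝓘(ℝ, EuclideanSpace ℝ (Fin n)) ∞ (fun q => ψ q • x) p :=
        (ψ.contMDiff p).smul contMDiffAt_const
      refine h1.congr_of_eventuallyEq ?_
      filter_upwards [(isOpen_extChartAt_source p₀).mem_nhds hs] with q hq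
      exact coord_of_eq_frame hq (map_smul (frame (n := n) p₀ q) (ψ q) x).symm
    · refine (contMDiff_zeroSection ℝ (fun q : M => TangentSpace (𝓡 n) q)
        p).congr_of_eventuallyEq ?_
      filter_upwards [(isClosed_tsupport ψ).isOpen_compl.mem_nhds hp] with q hq
      have : ψ q = 0 := image_eq_zero_of_notMem_tsupport hq
      simp [this, zeroSection]
  · intro p hp
    have : ψ p = 1 := hp
    simp [this]

theorem SmoothField.diffAt {X : Π p : M, TangentSpace (𝓡 n) p} (hX : SmoothField X) (p : M) :
    DiffAt X p :=
  (hX p).mdifferentiableAt (by simp)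

theorem pullForm_extChartAt {p₀ p : M} (hp : p ∈ (extChartAt (𝓡 n) p₀).source)
    (η : Π p : M, TangentSpace (𝓡 n) p →L[ℝ] V) (x : EuclideanSpace ℝ (Fin n)) :
    pullForm p₀ η (extChartAt (𝓡 n) p₀ p) x = η p (frame p₀ p x) := by
  rw [pullForm, (extChartAt (𝓡 n) p₀).left_inv hp, ContinuousLinearMap.comp_apply]

/-- `mlieBracket` is defined by pulling fields back along the inverse chart. Its derivative is the
frame, so the pulled-back field consists of the frame components. -/
theorem mpullbackWithin_eventuallyEq_coord (p : M) (X : Π p : M, TangentSpace (𝓡 n) p) :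
    mpullbackWithin 𝓘(ℝ, EuclideanSpace ℝ (Fin n)) (𝓡 n) (extChartAt (𝓡 n) p).symm X
      (Set.range (𝓡 n)) =ᶠ[𝓝 (extChartAt (𝓡 n) p p)] coord p X ∘ (extChartAt (𝓡 n) p).symm := by
  filter_upwards [(isOpen_target p).mem_nhds (mem_extChartAt_target p)] with u hu
  have : IsManifold (𝓡 n) 1 M := IsManifold.of_le (n := ∞) (by norm_cast)
  have hs := (extChartAt (𝓡 n) p).map_target hu
  have h := frame_eq_mfderiv hs
  rw [(extChartAt (𝓡 n) p).right_inv hu] at h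
  have h2 := isInvertible_mfderivWithin_extChartAt_symm (I := 𝓡 n) hu
  rw [mpullbackWithin_apply, ModelWithCorners.range_eq_univ, mfderivWithin_univ,
    Function.comp_apply]
  rw [ModelWithCorners.range_eq_univ, mfderivWithin_univ] at h2
  refine h2.inverse_apply_eq.2 ((frame_coord hs X).symm.trans ?_)
  rw [h]
  rfl

/-- The classical formula `[X, Y] = DY(X) - DX(Y)` for components, valid when the fields are merely
differentiable at the point. -/
theorem mlieBracket_eq_coord {X Y : Π p : M, TangentSpace (𝓡 n) p} {p : M} (hX : DiffAt X p)
    (hY : DiffAt Y p) : mlieBracket (𝓡 n) X Y p =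
      frame p p (mvfderiv (𝓡 n) (coord p Y) p (X p) - mvfderiv (𝓡 n) (coord p X) p (Y p)) := by
  have : IsManifold (𝓡 n) 1 M := IsManifold.of_le (n := ∞) (by norm_cast)
  have hp := mem_extChartAt_source (I := 𝓡 n) p
  have hder : ∀ Z W : Π p : M, TangentSpace (𝓡 n) p, DiffAt Z p →
      fderiv ℝ (mpullbackWithin 𝓘(ℝ, EuclideanSpace ℝ (Fin n)) (𝓡 n) (extChartAt (𝓡 n) p).symm Z
        (Set.range (𝓡 n))) (extChartAt (𝓡 n) p p)
        (mpullbackWithin 𝓘(ℝ, EuclideanSpace ℝ (Fin n)) (𝓡 n) (extChartAt (𝓡 n) p).symm W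
          (Set.range (𝓡 n)) (extChartAt (𝓡 n) p p)) =
      mvfderiv (𝓡 n) (coord p Z) p (W p) := by
    intro Z W hZ
    have h1 := (diffAt_iff_coord hp Z).1 hZ
    have h2 := (hasFDerivAt_comp_extChartAt_symm (n := n) (G := coord p Z)
      (mem_extChartAt_target p) (by rwa [extChartAt_to_inv])).fderiv
    have h3 := (mpullbackWithin_eventuallyEq_coord p W).self_of_nhds
    rw [Function.comp_apply, extChartAt_to_inv] at h3
    have h4 := ((mpullbackWithin_eventuallyEq_coord p Z).fderiv_eq).trans h2
    refine (congrArg₂ (fun (L : EuclideanSpace ℝ (Fin n) →L[ℝ] EuclideanSpace ℝ (Fin n)) x => L x)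
      h4 h3).trans ?_
    exact (pullForm_extChartAt hp _ _).trans (by rw [frame_coord hp])
  rw [← mlieBracketWithin_univ, mlieBracketWithin_apply]
  refine (isInvertible_mfderiv_extChartAt hp).inverse_apply_eq.2 ?_
  have hinv := mfderiv_extChartAt_comp_mfderivWithin_extChartAt_symm' (I := 𝓡 n) hp
  rw [ModelWithCorners.range_eq_univ, mfderivWithin_univ, ← frame_eq_mfderiv hp] at hinv
  refine Eq.trans ?_ (congrArg (fun L : EuclideanSpace ℝ (Fin n) →L[ℝ] EuclideanSpace ℝ (Fin n) =>
    L (mvfderiv (𝓡 n) (coord p Y) p (X p) - mvfderiv (𝓡 n) (coord p X) p (Y p))) hinv).symm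
  have hset : (extChartAt (𝓡 n) p).symm ⁻¹' Set.univ ∩ Set.range (𝓡 n) = Set.univ := by
    rw [ModelWithCorners.range_eq_univ, Set.preimage_univ, Set.univ_inter]
  rw [hset]
  have hbr : ∀ (F G : EuclideanSpace ℝ (Fin n) → EuclideanSpace ℝ (Fin n)) u,
      lieBracketWithin ℝ F G Set.univ u = fderiv ℝ G u (F u) - fderiv ℝ F u (G u) := by
    intro F G u
    rw [lieBracketWithin_univ]
    rfl
  have h5 : lieBracketWithin ℝ
      (mpullbackWithin 𝓘(ℝ, EuclideanSpace ℝ (Fin n)) (𝓡 n) (extChartAt (𝓡 n) p).symm X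
        (Set.range (𝓡 n)))
      (mpullbackWithin 𝓘(ℝ, EuclideanSpace ℝ (Fin n)) (𝓡 n) (extChartAt (𝓡 n) p).symm Y
        (Set.range (𝓡 n))) Set.univ (extChartAt (𝓡 n) p p) =
      mvfderiv (𝓡 n) (coord p Y) p (X p) - mvfderiv (𝓡 n) (coord p X) p (Y p) := by
    rw [← hder X Y hX, ← hder Y X hY]
    exact hbr _ _ _
  exact h5

/-- The product rule separates a coordinate Hessian term, which cancels in commutators, from the
derivative of the components of `Y`. -/
theorem mvfderiv_mvfderiv_apply {G : M → V} (hG : ContMDiff (𝓡 n) 𝓘(ℝ, V) ∞ G)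
    {Y : Π p : M, TangentSpace (𝓡 n) p} {p₀ p : M} (hp : p ∈ (extChartAt (𝓡 n) p₀).source)
    (hY : DiffAt Y p) (x : EuclideanSpace ℝ (Fin n)) :
    mvfderiv (𝓡 n) (fun q => mvfderiv (𝓡 n) G q (Y q)) p (frame p₀ p x) =
      fderiv ℝ (pullForm p₀ (mvfderiv (𝓡 n) G)) (extChartAt (𝓡 n) p₀ p) x (coord p₀ Y p) +
        mvfderiv (𝓡 n) G p (frame p₀ p (mvfderiv (𝓡 n) (coord p₀ Y) p (frame p₀ p x))) := by
  have hd := mdifferentiableAt_mvfderiv_apply hG hY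
  have hu := (extChartAt (𝓡 n) p₀).map_source hp
  have hinv := (extChartAt (𝓡 n) p₀).left_inv hp
  have h1 := hasFDerivAt_comp_extChartAt_symm hu (by rwa [hinv])
  have h2 := hasFDerivAt_comp_extChartAt_symm (G := coord p₀ Y) hu
    (by rw [hinv]; exact (diffAt_iff_coord hp Y).1 hY)
  have h3 := ((((contDiffOn_pullForm_mvfderiv hG p₀).contDiffAt ((isOpen_target p₀).mem_nhds
    hu)).differentiableAt (by simp)).hasFDerivAt).clm_apply h2
  have h4 : (fun q => mvfderiv (𝓡 n) G q (Y q)) ∘ (extChartAt (𝓡 n) p₀).symm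
      =ᶠ[𝓝 (extChartAt (𝓡 n) p₀ p)] fun u =>
        pullForm p₀ (mvfderiv (𝓡 n) G) u ((coord p₀ Y ∘ (extChartAt (𝓡 n) p₀).symm) u) := by
    filter_upwards [(isOpen_target p₀).mem_nhds hu] with u hu'
    have := form_eq_pullForm_coord ((extChartAt (𝓡 n) p₀).map_target hu') (mvfderiv (𝓡 n) G) Y
    rwa [(extChartAt (𝓡 n) p₀).right_inv hu'] at this
  have h5 := h1.unique (h3.congr_of_eventuallyEq h4)
  have h6 := congrArg (fun L : EuclideanSpace ℝ (Fin n) →L[ℝ] V => L x) h5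
  simp only [add_apply, ContinuousLinearMap.comp_apply, ContinuousLinearMap.flip_apply,
    Function.comp_apply, hinv, pullForm_extChartAt hp] at h6
  rw [h6, add_comm]

/-- The commutator of the derivations by two vector fields is the derivation by their Lie bracket. -/
theorem mvfderiv_apply_mlieBracket {G : M → V} (hG : ContMDiff (𝓡 n) 𝓘(ℝ, V) ∞ G)
    {X Y : Π p : M, TangentSpace (𝓡 n) p} {p : M} (hX : DiffAt X p) (hY : DiffAt Y p) :
    mvfderiv (𝓡 n) (fun q => mvfderiv (𝓡 n) G q (Y q)) p (X p) -
      mvfderiv (𝓡 n) (fun q => mvfderiv (𝓡 n) G q (X q)) p (Y p) =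
      mvfderiv (𝓡 n) G p (mlieBracket (𝓡 n) X Y p) := by
  have hp := mem_extChartAt_source (I := 𝓡 n) p
  have h1 := mvfderiv_mvfderiv_apply hG hp hY (coord p X p)
  have h2 := mvfderiv_mvfderiv_apply hG hp hX (coord p Y p)
  rw [frame_coord hp] at h1 h2
  rw [h1, h2, mlieBracket_eq_coord hX hY,
    fderiv_pullForm_mvfderiv_symm hG (mem_extChartAt_target p), map_sub, map_sub]
  abel

end Fields

/-! ### Differentiating inner products -/

section Inner

variable {n : ℕ} {M : Type*} [TopologicalSpace M] [ChartedSpace (EuclideanSpace ℝ (Fin n)) M]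
  [IsManifold (𝓡 n) ∞ M] {V : Type*} [NormedAddCommGroup V] [InnerProductSpace ℝ V]

omit [IsManifold (𝓡 n) ∞ M] in
theorem MDifferentiableAt.inner_vector {F G : M → V} {p : M}
    (hF : MDifferentiableAt (𝓡 n) 𝓘(ℝ, V) F p) (hG : MDifferentiableAt (𝓡 n) 𝓘(ℝ, V) G p) :
    MDifferentiableAt (𝓡 n) 𝓘(ℝ) (fun q => ⟪F q, G q⟫) p :=
  ((contDiff_inner (𝕜 := ℝ) (E := V) (n := 1)).differentiable
    (by norm_num)).differentiableAt.mdifferentiableAt.comp p (hF.prodMk_space hG)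

theorem mvfderiv_inner {F G : M → V} {p : M} (hF : MDifferentiableAt (𝓡 n) 𝓘(ℝ, V) F p)
    (hG : MDifferentiableAt (𝓡 n) 𝓘(ℝ, V) G p) (v : TangentSpace (𝓡 n) p) :
    mvfderiv (𝓡 n) (fun q => ⟪F q, G q⟫) p v =
      ⟪F p, mvfderiv (𝓡 n) G p v⟫ + ⟪mvfderiv (𝓡 n) F p v, G p⟫ := by
  have hp := mem_extChartAt_source (I := 𝓡 n) p
  have hu := mem_extChartAt_target (I := 𝓡 n) p
  have hinv := extChartAt_to_inv (I := 𝓡 n) p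
  obtain ⟨x, rfl⟩ := (frame_bijective hp).2 v
  have h1 := hasFDerivAt_comp_extChartAt_symm hu (hinv.symm ▸ hF)
  have h2 := hasFDerivAt_comp_extChartAt_symm hu (hinv.symm ▸ hG)
  have h3 := hasFDerivAt_comp_extChartAt_symm hu (hinv.symm ▸ hF.inner_vector hG)
  have h4 := congrArg (fun L : EuclideanSpace ℝ (Fin n) →L[ℝ] ℝ => L x)
    (h3.unique (h1.inner ℝ h2))
  simpa [pullForm_extChartAt hp, -extChartAt, hinv] using h4

omit [IsManifold (𝓡 n) ∞ M] in
theorem ContMDiff.inner_vector {F G : M → V} (hF : ContMDiff (𝓡 n) 𝓘(ℝ, V) ∞ F)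
    (hG : ContMDiff (𝓡 n) 𝓘(ℝ, V) ∞ G) : ContMDiff (𝓡 n) 𝓘(ℝ) ∞ (fun q => ⟪F q, G q⟫) :=
  (contDiff_inner (𝕜 := ℝ) (E := V) (n := ∞)).contMDiff.comp (hF.prodMk_space hG)

end Inner

/-! ### Gauss formula and the exterior derivative of `df ∘ Q` -/

section Hypersurface

variable {n : ℕ} {M : Type*} [TopologicalSpace M] [ChartedSpace (EuclideanSpace ℝ (Fin n)) M]
  [IsManifold (𝓡 n) ∞ M] {met : Metric n M} {f N : M → EuclideanSpace ℝ (Fin (n + 1))}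
  {A : Π p : M, TangentSpace (𝓡 n) p →L[ℝ] TangentSpace (𝓡 n) p}

theorem injective_mvfderiv (hf : IsIsometricImmersion met f) (p : M) :
    Function.Injective (mvfderiv (𝓡 n) f p) := by
  rw [injective_iff_map_eq_zero]
  intro v hv
  by_contra hne
  have h := met.pos p v hne
  rw [← hf.isometric, hv, inner_zero_left] at h
  exact lt_irrefl _ h

/-- A vector is determined by its tangential and normal components. -/
theorem eq_of_inner_tangent_normal (hf : IsIsometricImmersion met f) (hN : IsUnitNormal f N)
    {p : M} {v w : EuclideanSpace ℝ (Fin (n + 1))}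
    (ht : ∀ z, ⟪v, mvfderiv (𝓡 n) f p z⟫ = ⟪w, mvfderiv (𝓡 n) f p z⟫)
    (hn : ⟪v, N p⟫ = ⟪w, N p⟫) : v = w := by
  rw [← sub_eq_zero]
  refine eq_zero_of_inner_hyperplane (T := mvfderiv (𝓡 n) f p ∘L frame p p) (by simp)
    ((injective_mvfderiv hf p).comp (frame_bijective (mem_extChartAt_source p)).1) (hN.norm_eq p)
    (fun y => hN.normal p _) (fun y => ?_) ?_
  · rw [inner_sub_left, sub_eq_zero]
    exact ht _
  · rw [inner_sub_left, hn, sub_self]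

/-- The tangential part of the Gauss formula. -/
theorem inner_mvfderiv_mvfderiv (hf : IsIsometricImmersion met f)
    {Y : Π p : M, TangentSpace (𝓡 n) p} {p : M} (hY : DiffAt Y p) (v w : TangentSpace (𝓡 n) p) :
    ⟪mvfderiv (𝓡 n) (fun q => mvfderiv (𝓡 n) f q (Y q)) p v, mvfderiv (𝓡 n) f p w⟫ =
      met.inner p (leviCivita met Y p v) w := by
  -- The difference between the tangential part of the derivative of `df Y` and the Levi-Civita
  -- connection. It is symmetric in its first two arguments, both being torsion-free, and
  -- antisymmetric in the last two, both being metric. Six alternating exchanges then give `Δ = -Δ`.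
  let Δ : (Π p : M, TangentSpace (𝓡 n) p) → (Π p : M, TangentSpace (𝓡 n) p) →
      (Π p : M, TangentSpace (𝓡 n) p) → ℝ := fun X Y Z =>
    ⟪mvfderiv (𝓡 n) (fun q => mvfderiv (𝓡 n) f q (Y q)) p (X p), mvfderiv (𝓡 n) f p (Z p)⟫ -
      met.inner p (leviCivita met Y p (X p)) (Z p)
  have hsymm : ∀ X Y Z, DiffAt X p → DiffAt Y p → DiffAt Z p → Δ X Y Z = Δ Y X Z := by
    intro X Y Z hX hY hZ
    have h1 := congrArg (fun v => ⟪v, mvfderiv (𝓡 n) f p (Z p)⟫)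
      (mvfderiv_apply_mlieBracket hf.smooth hX hY)
    have h2 := congrArg (fun v => met.inner p v (Z p)) (leviCivita_torsion met hX hY)
    simp only [inner_sub_left, hf.isometric] at h1
    simp only [map_sub, sub_apply] at h2
    simp only [Δ]
    linarith
  have hanti : ∀ X Y Z, DiffAt X p → DiffAt Y p → DiffAt Z p → Δ X Y Z = -Δ X Z Y := by
    intro X Y Z hX hY hZ
    have h1 := mvfderiv_inner (mdifferentiableAt_mvfderiv_apply hf.smooth hY)
      (mdifferentiableAt_mvfderiv_apply hf.smooth hZ) (X p)
    have h2 := leviCivita_metric met hX hY hZ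
    simp only [hf.isometric] at h1
    rw [h1, real_inner_comm, met.symm p (Y p)] at h2
    simp only [Δ]
    linarith
  obtain ⟨X, hX, rfl⟩ := exists_field p v
  obtain ⟨Z, hZ, rfl⟩ := exists_field p w
  have e1 := hsymm X Y Z hX hY hZ
  have e2 := hanti Y X Z hY hX hZ
  have e3 := hsymm Y Z X hY hZ hX
  have e4 := hanti Z Y X hZ hY hX
  have e5 := hsymm Z X Y hZ hX hY
  have e6 := hanti X Z Y hX hZ hY
  have e7 : Δ X Y Z = 0 := by linarith
  simp only [Δ] at e7
  linarith

/-- The normal part of the Gauss formula. -/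
theorem inner_mvfderiv_mvfderiv_normal (hf : IsIsometricImmersion met f) (hN : IsUnitNormal f N)
    (hA : IsShapeOperator f N A) {Y : Π p : M, TangentSpace (𝓡 n) p} {p : M} (hY : DiffAt Y p)
    (v : TangentSpace (𝓡 n) p) :
    ⟪mvfderiv (𝓡 n) (fun q => mvfderiv (𝓡 n) f q (Y q)) p v, N p⟫ =
      met.inner p (A p v) (Y p) := by
  have h1 := mvfderiv_inner ((hN.smooth p).mdifferentiableAt (by simp))
    (mdifferentiableAt_mvfderiv_apply hf.smooth hY) v
  have h2 : (fun q => ⟪N q, mvfderiv (𝓡 n) f q (Y q)⟫) = fun _ => (0 : ℝ) := by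
    funext q
    exact hN.normal q _
  rw [h2, mvfderiv_const, hA, inner_neg_left, hf.isometric, real_inner_comm] at h1
  simp only [zero_apply] at h1
  linarith

/-- The Gauss formula. -/
theorem gauss_formula (hf : IsIsometricImmersion met f) (hN : IsUnitNormal f N)
    (hA : IsShapeOperator f N A) {Y : Π p : M, TangentSpace (𝓡 n) p} {p : M} (hY : DiffAt Y p)
    (v : TangentSpace (𝓡 n) p) :
    mvfderiv (𝓡 n) (fun q => mvfderiv (𝓡 n) f q (Y q)) p v =
      mvfderiv (𝓡 n) f p (leviCivita met Y p v) + met.inner p (A p v) (Y p) • N p := by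
  refine eq_of_inner_tangent_normal (p := p) hf hN (fun z => ?_) ?_
  · rw [inner_mvfderiv_mvfderiv hf hY, inner_add_left, hf.isometric, real_inner_smul_left,
      hN.normal, mul_zero, add_zero]
  · rw [inner_mvfderiv_mvfderiv_normal hf hN hA hY, inner_add_left, real_inner_smul_left,
      real_inner_self_eq_norm_sq, hN.norm_eq, real_inner_comm, hN.normal]
    ring

/-- The shape operator is self-adjoint. -/
theorem shape_selfAdjoint (hf : IsIsometricImmersion met f) (hN : IsUnitNormal f N)
    (hA : IsShapeOperator f N A) (p : M) (v w : TangentSpace (𝓡 n) p) :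
    met.inner p (A p v) w = met.inner p v (A p w) := by
  obtain ⟨X, hX, rfl⟩ := exists_field p v
  obtain ⟨Y, hY, rfl⟩ := exists_field p w
  -- The commutator of the two derivatives is `df [X, Y]`, which has no normal part.
  have h := congrArg (fun v => ⟪v, N p⟫) (mvfderiv_apply_mlieBracket hf.smooth hX hY)
  simp only [inner_sub_left, inner_mvfderiv_mvfderiv_normal hf hN hA hX,
    inner_mvfderiv_mvfderiv_normal hf hN hA hY] at h
  rw [real_inner_comm, hN.normal, sub_eq_zero] at h
  rw [h, met.symm]

/-- For a field with constant components near `p`, the product rule has no second term. This links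
the intrinsic Gauss formula to coordinate derivatives. -/
theorem fderiv_pullForm_of_eq_frame {V : Type*} [NormedAddCommGroup V] [NormedSpace ℝ V]
    {η : Π p : M, TangentSpace (𝓡 n) p →L[ℝ] V} {p₀ p : M}
    (hη : ContDiffOn ℝ ∞ (pullForm p₀ η) (extChartAt (𝓡 n) p₀).target)
    (hp : p ∈ (extChartAt (𝓡 n) p₀).source) {Y : Π p : M, TangentSpace (𝓡 n) p}
    {y : EuclideanSpace ℝ (Fin n)} (hY : ∀ᶠ q in 𝓝 p, Y q = frame p₀ q y)
    (x : EuclideanSpace ℝ (Fin n)) :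
    mvfderiv (𝓡 n) (fun q => η q (Y q)) p (frame p₀ p x) =
      fderiv ℝ (pullForm p₀ η) (extChartAt (𝓡 n) p₀ p) x y := by
  have hu := (extChartAt (𝓡 n) p₀).map_source hp
  have h1 : HasFDerivAt (fun u => pullForm p₀ η u y)
      ((fderiv ℝ (pullForm p₀ η) (extChartAt (𝓡 n) p₀ p)).flip y) (extChartAt (𝓡 n) p₀ p) :=
    ((hη.contDiffAt ((isOpen_target p₀).mem_nhds hu)).differentiableAt
      (by simp)).hasFDerivAt.clm_apply_vector y
  have hd := mdifferentiableAt_comp_extChartAt hp h1.differentiableAt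
  have h2 : (fun q => η q (Y q)) =ᶠ[𝓝 p] (fun u => pullForm p₀ η u y) ∘ extChartAt (𝓡 n) p₀ := by
    filter_upwards [hY, (isOpen_extChartAt_source p₀).mem_nhds hp] with q hq hqs
    rw [Function.comp_apply, pullForm_extChartAt hqs, hq]
  rw [mvfderiv_congr h2]
  have h3 := hasFDerivAt_comp_extChartAt_symm hu
    (((extChartAt (𝓡 n) p₀).left_inv hp).symm ▸ hd)
  have h4 : ((fun u => pullForm p₀ η u y) ∘ extChartAt (𝓡 n) p₀) ∘ (extChartAt (𝓡 n) p₀).symm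
      =ᶠ[𝓝 (extChartAt (𝓡 n) p₀ p)] fun u => pullForm p₀ η u y := by
    filter_upwards [(isOpen_target p₀).mem_nhds hu] with w hw
    simp only [Function.comp_apply, (extChartAt (𝓡 n) p₀).right_inv hw]
  have h5 := congrArg (fun L : EuclideanSpace ℝ (Fin n) →L[ℝ] V => L x)
    ((h4.hasFDerivAt_iff.1 h3).unique h1)
  simpa only [pullForm_extChartAt hp, ContinuousLinearMap.flip_apply] using h5

/-- The normal component of the derivative of `df ∘ Q` in coordinates. -/
theorem inner_fderiv_pullForm_normal (hf : IsIsometricImmersion met f) (hN : IsUnitNormal f N)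
    (hA : IsShapeOperator f N A)
    {Q : Π p : M, TangentSpace (𝓡 n) p →L[ℝ] TangentSpace (𝓡 n) p} (hQ : SmoothTensor Q)
    {p₀ p : M} (hp : p ∈ (extChartAt (𝓡 n) p₀).source) (x y : EuclideanSpace ℝ (Fin n)) :
    ⟪fderiv ℝ (pullForm p₀ (fun p => mvfderiv (𝓡 n) f p ∘L Q p)) (extChartAt (𝓡 n) p₀ p) x y,
      N p⟫ = met.inner p (A p (frame p₀ p x)) (Q p (frame p₀ p y)) := by
  rw [← fderiv_pullForm_of_eq_frame (contDiffOn_pullForm_mvfderiv_comp hf.smooth hQ p₀) hp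
    (Y := fun q => frame p₀ q y) (.of_forall fun _ => rfl)]
  exact inner_mvfderiv_mvfderiv_normal hf hN hA (Y := fun q => Q q (frame p₀ q y))
    ((contMDiffAt_tensor_apply hQ (contMDiffAt_frame hp y)).mdifferentiableAt (by simp)) _

/-- For a Codazzi tensor `Q`, the exterior derivative of `df ∘ Q` is normal. -/
theorem fderiv_pullForm_codazzi [T2Space M] (hf : IsIsometricImmersion met f)
    (hN : IsUnitNormal f N) (hA : IsShapeOperator f N A)
    {Q : Π p : M, TangentSpace (𝓡 n) p →L[ℝ] TangentSpace (𝓡 n) p} (hQ : IsCodazzi met Q)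
    (p₀ : M) : ∀ᶠ p in 𝓝 p₀, ∀ x y,
      fderiv ℝ (pullForm p₀ (fun p => mvfderiv (𝓡 n) f p ∘L Q p)) (extChartAt (𝓡 n) p₀ p) x y -
      fderiv ℝ (pullForm p₀ (fun p => mvfderiv (𝓡 n) f p ∘L Q p)) (extChartAt (𝓡 n) p₀ p) y x =
      (met.inner p (A p (frame p₀ p x)) (Q p (frame p₀ p y)) -
        met.inner p (A p (frame p₀ p y)) (Q p (frame p₀ p x))) • N p := by
  obtain ⟨W, hW, hX⟩ := exists_smoothField_eq_frame (n := n) p₀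
  filter_upwards [eventually_mem_nhds_iff.2 hW, extChartAt_source_mem_nhds (I := 𝓡 n) p₀]
    with p hpW hp x y
  obtain ⟨X, hXs, hXf⟩ := hX x
  obtain ⟨Y, hYs, hYf⟩ := hX y
  have hXe : ∀ᶠ q in 𝓝 p, X q = frame p₀ q x := Filter.mem_of_superset hpW hXf
  have hYe : ∀ᶠ q in 𝓝 p, Y q = frame p₀ q y := Filter.mem_of_superset hpW hYf
  have hXp := hXe.self_of_nhds
  have hYp := hYe.self_of_nhds
  have hη := contDiffOn_pullForm_mvfderiv_comp hf.smooth hQ.smooth p₀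
  have hQd : ∀ {Z : Π p : M, TangentSpace (𝓡 n) p}, SmoothField Z →
      DiffAt (fun q => Q q (Z q)) p := fun hZ =>
    (contMDiffAt_tensor_apply hQ.smooth (hZ p)).mdifferentiableAt (by simp)
  -- Coordinate fields commute: `df` of their bracket is the antisymmetrized coordinate Hessian of
  -- `f`, which is zero, and `df` is injective.
  have hbr : mlieBracket (𝓡 n) X Y p = 0 := by
    apply (injective_iff_map_eq_zero _).1 (injective_mvfderiv hf p)
    rw [← mvfderiv_apply_mlieBracket hf.smooth (SmoothField.diffAt hXs p) (SmoothField.diffAt hYs p), hXp, hYp,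
      fderiv_pullForm_of_eq_frame (contDiffOn_pullForm_mvfderiv hf.smooth p₀) hp hXe,
      fderiv_pullForm_of_eq_frame (contDiffOn_pullForm_mvfderiv hf.smooth p₀) hp hYe,
      fderiv_pullForm_mvfderiv_symm hf.smooth ((extChartAt (𝓡 n) p₀).map_source hp), sub_self]
  -- As the bracket vanishes, `∇_X Y = ∇_Y X`, and the Codazzi equation reduces to `∇_X (QY) = ∇_Y
  -- (QX)`.
  have hcov : leviCivita met (fun q => Q q (Y q)) p (X p) -
      leviCivita met (fun q => Q q (X q)) p (Y p) = 0 := by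
    have h1 := hQ.codazzi X Y hXs hYs p
    have h2 := leviCivita_torsion met (SmoothField.diffAt hXs p) (SmoothField.diffAt hYs p)
    rw [hbr, sub_eq_zero] at h2
    simp only [covDeriv, h2] at h1
    rw [sub_eq_zero]
    exact sub_left_injective h1
  have e1 := gauss_formula hf hN hA (hQd hYs) (X p)
  have e2 := gauss_formula hf hN hA (hQd hXs) (Y p)
  have d1 := fderiv_pullForm_of_eq_frame hη hp hYe x
  have d2 := fderiv_pullForm_of_eq_frame hη hp hXe y
  simp only [ContinuousLinearMap.comp_apply] at d1 d2
  rw [← d1, ← d2, ← hXp, ← hYp, e1, e2, sub_smul]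
  have h3 := congrArg (mvfderiv (𝓡 n) f p) hcov
  rw [map_sub, map_zero, sub_eq_zero] at h3
  rw [h3]
  abel

end Hypersurface

/-! ### Immersions of the metric `⟨Q²·, ·⟩` -/

section Codazzi

variable {n : ℕ} {M : Type*} [TopologicalSpace M] [ChartedSpace (EuclideanSpace ℝ (Fin n)) M]
  [IsManifold (𝓡 n) ∞ M] {met : Metric n M} {f f' N : M → EuclideanSpace ℝ (Fin (n + 1))}
  {A Q : Π p : M, TangentSpace (𝓡 n) p →L[ℝ] TangentSpace (𝓡 n) p}

omit [IsManifold (𝓡 n) ∞ M] in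
theorem mvfderiv_linearIsometry_comp {V V' : Type*} [NormedAddCommGroup V] [NormedSpace ℝ V]
    [NormedAddCommGroup V'] [NormedSpace ℝ V'] (Ψ : V →ₗᵢ[ℝ] V') {G : M → V} {p : M}
    (hG : MDifferentiableAt (𝓡 n) 𝓘(ℝ, V) G p) (v : TangentSpace (𝓡 n) p) :
    mvfderiv (𝓡 n) (fun q => Ψ (G q)) p v = Ψ (mvfderiv (𝓡 n) G p v) :=
  congrArg (fun L => L v)
    (Ψ.toContinuousLinearMap.hasMFDerivAt.comp p hG.hasMFDerivAt).mfderiv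

/-- Puts the rank hypothesis into the form used by the minors argument: `a` lifts independent
vectors in the range of `B`, and `b` represents dual functionals through the metric. -/
theorem exists_biorthogonal (met : Metric n M) (p : M)
    (B : TangentSpace (𝓡 n) p →L[ℝ] TangentSpace (𝓡 n) p) {k : ℕ}
    (h : k ≤ Module.finrank ℝ (LinearMap.range B.toLinearMap)) :
    ∃ a b : Fin k → TangentSpace (𝓡 n) p, ∀ i j,
      met.inner p (B (a i)) (b j) = if i = j then 1 else 0 := by
  have : FiniteDimensional ℝ (TangentSpace (𝓡 n) p) :=
    inferInstanceAs (FiniteDimensional ℝ (EuclideanSpace ℝ (Fin n)))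
  have : T2Space (TangentSpace (𝓡 n) p) :=
    inferInstanceAs (T2Space (EuclideanSpace ℝ (Fin n)))
  obtain ⟨g, hg⟩ := exists_linearIndependent_of_le_finrank h
  choose a ha using fun i => (g i).2
  have hB : LinearIndependent ℝ (fun i => B (a i)) := by
    have h1 := hg.map' (LinearMap.range B.toLinearMap).subtype
      (Submodule.ker_subtype _)
    have h2 : (LinearMap.range B.toLinearMap).subtype ∘ g = fun i => B (a i) :=
      funext fun i => (ha i).symm
    rwa [h2] at h1
  obtain ⟨l, hl⟩ := LinearMap.exists_leftInverse_of_injective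
    (Fintype.linearCombination ℝ (fun i => B (a i)))
    (LinearMap.ker_eq_bot.2 hB.fintypeLinearCombination_injective)
  choose b hb using fun j => exists_riesz met p
    (LinearMap.toContinuousLinearMap (LinearMap.proj j ∘ₗ l))
  refine ⟨a, b, fun i j => ?_⟩
  have h3 := congrArg (fun L : (Fin k → ℝ) →ₗ[ℝ] (Fin k → ℝ) => L (Pi.single i 1) j) hl
  simp only [LinearMap.comp_apply, Fintype.linearCombination_apply_single, one_smul,
    LinearMap.id_apply] at h3
  rw [met.symm, hb]
  simp only [LinearMap.coe_toContinuousLinearMap', LinearMap.comp_apply, LinearMap.proj_apply, h3,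
    Pi.single_apply, eq_comm]

/-- A linear isometry intertwining two tangent planes along a hypersurface. -/
theorem exists_linearIsometry_near [T2Space M] (hf : IsIsometricImmersion met f)
    (hN : IsUnitNormal f N) (hA : IsShapeOperator f N A)
    (hrank : ∀ p, 3 ≤ Module.finrank ℝ (LinearMap.range (A p).toLinearMap))
    (hQ : IsCodazzi met Q) (hns : ∀ p, (Q p).IsInvertible)
    (hf' : IsIsometricImmersion (sqMetric met Q hQ hns) f') (p₀ : M) :
    ∃ Ψ : EuclideanSpace ℝ (Fin (n + 1)) →ₗᵢ[ℝ] EuclideanSpace ℝ (Fin (n + 1)),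
      ∀ᶠ p in 𝓝 p₀, ∀ v, mvfderiv (𝓡 n) f' p v = Ψ (mvfderiv (𝓡 n) f p (Q p v)) := by
  let φ := extChartAt (𝓡 n) p₀
  have hcod := fderiv_pullForm_codazzi hf hN hA hQ p₀
  have hcod' : ∀ᶠ u in 𝓝 (φ p₀), ∀ x y,
      fderiv ℝ (pullForm p₀ (fun p => mvfderiv (𝓡 n) f p ∘L Q p)) u x y -
        fderiv ℝ (pullForm p₀ (fun p => mvfderiv (𝓡 n) f p ∘L Q p)) u y x =
      (met.inner (φ.symm u) (A _ (frame p₀ _ x)) (Q _ (frame p₀ _ y)) -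
        met.inner (φ.symm u) (A _ (frame p₀ _ y)) (Q _ (frame p₀ _ x))) • N (φ.symm u) := by
    have h1 : Filter.Tendsto φ.symm (𝓝 (φ p₀)) (𝓝 p₀) := by
      have h2 := (continuousAt_extChartAt_symm (I := 𝓡 n) p₀).tendsto
      rwa [extChartAt_to_inv] at h2
    filter_upwards [h1.eventually hcod, (isOpen_target p₀).mem_nhds (mem_extChartAt_target p₀)]
      with u hu hut x y
    rw [← hu x y, φ.right_inv hut]
  obtain ⟨r, hr, hball⟩ := Metric.mem_nhds_iff.1 (Filter.inter_mem hcod'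
    ((isOpen_target p₀).mem_nhds (mem_extChartAt_target p₀)))
  have hsub : Metric.ball (φ p₀) r ⊆ φ.target := fun u hu => (hball hu).2
  have hle : (2 : WithTop ℕ∞) ≤ ∞ := by norm_cast
  obtain ⟨Ψ, hΨ⟩ := exists_linearIsometry_of_gram_eq (by simp) Metric.isOpen_ball
    (convex_ball (φ p₀) r)
    (T := pullForm p₀ (fun p => mvfderiv (𝓡 n) f p ∘L Q p))
    (T' := pullForm p₀ (mvfderiv (𝓡 n) f')) (N := N ∘ φ.symm)
    (((contDiffOn_pullForm_mvfderiv_comp hf.smooth hQ.smooth p₀).of_le hle).mono hsub)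
    (((contDiffOn_pullForm_mvfderiv hf'.smooth p₀).of_le hle).mono hsub)
    (fun u hu => (injective_mvfderiv hf _).comp ((hns _).injective.comp
      (frame_bijective (φ.map_target (hsub hu))).1))
    (fun u _ x y => by
      simp only [pullForm, ContinuousLinearMap.comp_apply, hf.isometric, hf'.isometric,
        sqMetric_apply]
      rw [hQ.selfAdjoint])
    (fun u hu x y z => by
      rw [(hball hu).1 x y, real_inner_smul_left]
      simp only [pullForm, ContinuousLinearMap.comp_apply]
      rw [hN.normal, mul_zero])
    (fun u hu => fderiv_pullForm_mvfderiv_symm hf'.smooth (hsub hu))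
    (fun u _ => hN.norm_eq _) (fun u _ y => hN.normal _ _)
    (fun u hu => by
      have hs := φ.map_target (hsub hu)
      obtain ⟨a, b, hab⟩ := exists_biorthogonal met (φ.symm u) (A _) (hrank _)
      choose a' ha' using fun i => (frame_bijective hs).2 (a i)
      -- The normal form of the frame `df ∘ Q` is `⟨A·, Q·⟩`, so `Q⁻¹` is applied to the second
      -- family to restore biorthogonality.
      choose b' hb' using fun i => (frame_bijective hs).2 ((Q (φ.symm u)).inverse (b i))
      refine ⟨a', b', fun i j => ?_⟩
      have h1 := inner_fderiv_pullForm_normal hf hN hA hQ.smooth hs (a' i) (b' j)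
      rw [φ.right_inv (hsub hu)] at h1
      rw [Function.comp_apply, h1, ha', hb', ← hab i j]
      congr 1
      exact (hns _).self_apply_inverse (b j))
  refine ⟨Ψ, ?_⟩
  have hnear : ∀ᶠ q in 𝓝 p₀, φ q ∈ Metric.ball (φ p₀) r :=
    (continuousAt_extChartAt p₀).eventually (Metric.ball_mem_nhds _ hr)
  filter_upwards [hnear, extChartAt_source_mem_nhds (I := 𝓡 n) p₀] with p hp hps v
  obtain ⟨x, rfl⟩ := (frame_bijective hps).2 v
  have h1 := hΨ (φ p) hp x
  rw [pullForm_extChartAt hps, pullForm_extChartAt hps] at h1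
  exact h1.symm

/-- Two linear maps agreeing on the tangent planes of a curved hypersurface agree. -/
theorem linearIsometry_eq_of_tangent_eq (hf : IsIsometricImmersion met f)
    (hN : IsUnitNormal f N) (hA : IsShapeOperator f N A) {p : M} (hne : A p ≠ 0)
    {Ψ₁ Ψ₂ : EuclideanSpace ℝ (Fin (n + 1)) →ₗᵢ[ℝ] EuclideanSpace ℝ (Fin (n + 1))}
    (h : ∀ᶠ q in 𝓝 p, ∀ v, Ψ₁ (mvfderiv (𝓡 n) f q v) = Ψ₂ (mvfderiv (𝓡 n) f q v)) :
    Ψ₁ = Ψ₂ := by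
  obtain ⟨v, hv⟩ : ∃ v, A p v ≠ 0 := by
    by_contra hcon
    push Not at hcon
    exact hne (ContinuousLinearMap.ext hcon)
  -- With `Y p = A v`, the derivative of `df Y` along `v` has normal component `⟨Av, Av⟩ > 0`.
  -- Agreement on nearby tangent planes therefore forces agreement on `N p`.
  obtain ⟨Y, hY, hYp⟩ := exists_field p (A p v)
  have hd := mdifferentiableAt_mvfderiv_apply hf.smooth hY
  have hcomp := fun Ψ : EuclideanSpace ℝ (Fin (n + 1)) →ₗᵢ[ℝ] EuclideanSpace ℝ (Fin (n + 1)) =>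
    mvfderiv_linearIsometry_comp Ψ hd v
  have ht := h.self_of_nhds
  have hn : Ψ₁ (N p) = Ψ₂ (N p) := by
    have h1 := congrArg (fun L => L v) (mvfderiv_congr (n := n)
      (G := fun q => Ψ₁ (mvfderiv (𝓡 n) f q (Y q)))
      (H := fun q => Ψ₂ (mvfderiv (𝓡 n) f q (Y q))) (p := p) (h.mono fun q hq => hq _))
    simp only [hcomp, gauss_formula hf hN hA hY, map_add, map_smul, ht, add_right_inj, hYp] at h1
    exact smul_right_injective _ (met.pos p _ hv).ne' h1
  have htop : LinearMap.eqLocus Ψ₁.toLinearMap Ψ₂.toLinearMap = ⊤ := by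
    rw [← Submodule.orthogonal_eq_bot_iff, Submodule.eq_bot_iff]
    intro w hw
    rw [Submodule.mem_orthogonal'] at hw
    exact eq_of_inner_tangent_normal hf hN (p := p)
      (fun z => by rw [hw _ (ht z), inner_zero_left]) (by rw [hw _ hn, inner_zero_left])
  ext1 w
  exact (htop.symm ▸ Submodule.mem_top : w ∈ LinearMap.eqLocus Ψ₁.toLinearMap Ψ₂.toLinearMap)

omit [IsManifold (𝓡 n) ∞ M] in
theorem ne_zero_of_finrank_range {p : M}
    (h : 3 ≤ Module.finrank ℝ (LinearMap.range (A p).toLinearMap)) : A p ≠ 0 := by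
  intro h0
  rw [h0, ContinuousLinearMap.toLinearMap_zero, LinearMap.range_zero, finrank_bot] at h
  omega

/-- The differential of an isometric immersion of the metric `⟨Q²·, ·⟩` is `df ∘ Q` up to a
linear isometry. -/
theorem exists_linearIsometryEquiv_mvfderiv_eq [T2Space M] [PreconnectedSpace M]
    (hf : IsIsometricImmersion met f)
    (hN : IsUnitNormal f N) (hA : IsShapeOperator f N A)
    (hrank : ∀ p, 3 ≤ Module.finrank ℝ (LinearMap.range (A p).toLinearMap))
    (hQ : IsCodazzi met Q) (hns : ∀ p, (Q p).IsInvertible)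
    (hf' : IsIsometricImmersion (sqMetric met Q hQ hns) f') :
    ∃ Ψ : EuclideanSpace ℝ (Fin (n + 1)) ≃ₗᵢ[ℝ] EuclideanSpace ℝ (Fin (n + 1)),
      ∀ p v, mvfderiv (𝓡 n) f' p v = Ψ (mvfderiv (𝓡 n) f p (Q p v)) := by
  choose Ψ hΨ using exists_linearIsometry_near hf hN hA hrank hQ hns hf'
  have hlc : IsLocallyConstant Ψ := by
    rw [IsLocallyConstant.iff_eventually_eq]
    intro p
    filter_upwards [(hΨ p).eventually_nhds] with q hq
    refine linearIsometry_eq_of_tangent_eq hf hN hA (ne_zero_of_finrank_range (hrank q)) ?_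
    filter_upwards [hq, hΨ q] with z h1 h2 v
    obtain ⟨w, rfl⟩ := (hns z).surjective v
    rw [← h1, ← h2]
  rcases isEmpty_or_nonempty M with hM | ⟨⟨p₀⟩⟩
  · exact ⟨LinearIsometryEquiv.refl ℝ _, fun p => hM.elim p⟩
  · refine ⟨(Ψ p₀).toLinearIsometryEquiv rfl, fun p v => ?_⟩
    rw [LinearIsometry.toLinearIsometryEquiv_apply, ← hlc.apply_eq_of_preconnectedSpace p p₀]
    exact (hΨ p).self_of_nhds v

/-- Both operators are self-adjoint, so commutation is symmetry of the form `⟨A·, Q·⟩`, that is,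
vanishing of the normal part of the exterior derivative of `df ∘ Q`. -/
theorem inner_shape_codazzi_comm (hf : IsIsometricImmersion met f) (hN : IsUnitNormal f N)
    (hA : IsShapeOperator f N A) (hQ : IsCodazzi met Q) (p : M) :
    Q p ∘L A p = A p ∘L Q p ↔
      ∀ v w, met.inner p (A p v) (Q p w) = met.inner p (A p w) (Q p v) := by
  have hs := shape_selfAdjoint hf hN hA p
  constructor
  · intro h v w
    have h1 : ∀ z, Q p (A p z) = A p (Q p z) := fun z => congrArg (fun L => L z) h
    rw [← hQ.selfAdjoint, h1, hs, met.symm]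
  · intro h
    ext1 v
    refine eq_of_inner_eq met p fun w => ?_
    rw [ContinuousLinearMap.comp_apply, ContinuousLinearMap.comp_apply, hQ.selfAdjoint, h,
      hs (Q p v), met.symm]

/-- If the metric `⟨Q²·, ·⟩` is induced by a hypersurface, then `Q` commutes with `A`. -/
theorem comp_eq_comp_of_isometricImmersion [T2Space M] [PreconnectedSpace M]
    (hf : IsIsometricImmersion met f)
    (hN : IsUnitNormal f N) (hA : IsShapeOperator f N A)
    (hrank : ∀ p, 3 ≤ Module.finrank ℝ (LinearMap.range (A p).toLinearMap))
    (hQ : IsCodazzi met Q) (hns : ∀ p, (Q p).IsInvertible)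
    (hf' : IsIsometricImmersion (sqMetric met Q hQ hns) f') (p : M) :
    Q p ∘L A p = A p ∘L Q p := by
  obtain ⟨Ψ, hΨ⟩ := exists_linearIsometryEquiv_mvfderiv_eq hf hN hA hrank hQ hns hf'
  rw [inner_shape_codazzi_comm hf hN hA hQ]
  intro v w
  have hp := mem_extChartAt_source (I := 𝓡 n) p
  obtain ⟨x, rfl⟩ := (frame_bijective hp).2 v
  obtain ⟨y, rfl⟩ := (frame_bijective hp).2 w
  -- `df ∘ Q` is the image of the closed form `df'` under the constant map `Ψ⁻¹`, hence closed. Its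
  -- normal part gives the symmetry.
  have hT : pullForm p (fun p => mvfderiv (𝓡 n) f p ∘L Q p) =
      fun u => (Ψ.symm.toContinuousLinearEquiv : EuclideanSpace ℝ (Fin (n + 1)) →L[ℝ] _) ∘L
        pullForm p (mvfderiv (𝓡 n) f') u := by
    funext u
    ext1 z
    simp [pullForm, hΨ, -extChartAt]
  have hu := mem_extChartAt_target (I := 𝓡 n) p
  have hd := (((contDiffOn_pullForm_mvfderiv hf'.smooth p).contDiffAt
    ((isOpen_target p).mem_nhds hu)).differentiableAt (by simp)).hasFDerivAt
  have h1 : ∀ x y, fderiv ℝ (pullForm p (fun p => mvfderiv (𝓡 n) f p ∘L Q p))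
      (extChartAt (𝓡 n) p p) x y =
      Ψ.symm (fderiv ℝ (pullForm p (mvfderiv (𝓡 n) f')) (extChartAt (𝓡 n) p p) x y) := by
    intro x y
    rw [hT, ((hasFDerivAt_const _ _).clm_comp hd).fderiv]
    simp
  rw [← inner_fderiv_pullForm_normal hf hN hA hQ.smooth hp,
    ← inner_fderiv_pullForm_normal hf hN hA hQ.smooth hp, h1, h1,
    fderiv_pullForm_mvfderiv_symm hf'.smooth hu]

/-- If `Q` commutes with `A`, then `df ∘ Q` is exact. -/
theorem exists_mvfderiv_eq_comp [T2Space M] [SimplyConnectedSpace M]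
    (hf : IsIsometricImmersion met f)
    (hN : IsUnitNormal f N) (hA : IsShapeOperator f N A)
    (hQ : IsCodazzi met Q) (hcomm : ∀ p, Q p ∘L A p = A p ∘L Q p) :
    ∃ F : M → EuclideanSpace ℝ (Fin (n + 1)),
      ContMDiff (𝓡 n) 𝓘(ℝ, EuclideanSpace ℝ (Fin (n + 1))) ∞ F ∧
      ∀ p, mvfderiv (𝓡 n) F p = mvfderiv (𝓡 n) f p ∘L Q p := by
  refine exists_mvfderiv_eq_of_closed _
    (fun p₀ => contDiffOn_pullForm_mvfderiv_comp hf.smooth hQ.smooth p₀) fun p₀ => ?_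
  have h1 : Filter.Tendsto (extChartAt (𝓡 n) p₀).symm (𝓝 (extChartAt (𝓡 n) p₀ p₀)) (𝓝 p₀) := by
    have h2 := (continuousAt_extChartAt_symm (I := 𝓡 n) p₀).tendsto
    rwa [extChartAt_to_inv] at h2
  filter_upwards [h1.eventually (fderiv_pullForm_codazzi hf hN hA hQ p₀),
    (isOpen_target p₀).mem_nhds (mem_extChartAt_target p₀)] with u hu hut x y
  have h3 := hu x y
  rw [(inner_shape_codazzi_comm hf hN hA hQ _).1 (hcomm _) (frame p₀ _ x), sub_self, zero_smul,
    (extChartAt (𝓡 n) p₀).right_inv hut, sub_eq_zero] at h3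
  exact h3

theorem isIsometricImmersion_of_mvfderiv_eq (hf : IsIsometricImmersion met f)
    (hQ : IsCodazzi met Q) (hns : ∀ p, (Q p).IsInvertible)
    (hs : ContMDiff (𝓡 n) 𝓘(ℝ, EuclideanSpace ℝ (Fin (n + 1))) ∞ f')
    (hd : ∀ p, mvfderiv (𝓡 n) f' p = mvfderiv (𝓡 n) f p ∘L Q p) :
    IsIsometricImmersion (sqMetric met Q hQ hns) f' where
  smooth := hs
  isometric p v w := by
    rw [hd, ContinuousLinearMap.comp_apply, ContinuousLinearMap.comp_apply, hf.isometric,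
      sqMetric_apply, hQ.selfAdjoint p (Q p v)]

end Codazzi

/-! ### Potential pairs -/

section Gradient

variable {n : ℕ} {M : Type*} [TopologicalSpace M] [ChartedSpace (EuclideanSpace ℝ (Fin n)) M]
  [IsManifold (𝓡 n) ∞ M] {met : Metric n M} {f f' N : M → EuclideanSpace ℝ (Fin (n + 1))}
  {A Q : Π p : M, TangentSpace (𝓡 n) p →L[ℝ] TangentSpace (𝓡 n) p}

/-- The Gram form of an injective linear map into a Euclidean space is invertible. -/
theorem isInvertible_gram {E V : Type*} [NormedAddCommGroup E] [NormedSpace ℝ E]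
    [FiniteDimensional ℝ E] [NormedAddCommGroup V] [InnerProductSpace ℝ V] {T : E →L[ℝ] V}
    (hT : Function.Injective T) :
    ((ContinuousLinearMap.compL ℝ E V ℝ).flip T ∘L (innerSL ℝ ∘L T)).IsInvertible := by
  let G : E →L[ℝ] E →L[ℝ] ℝ := (ContinuousLinearMap.compL ℝ E V ℝ).flip T ∘L (innerSL ℝ ∘L T)
  have hinj : Function.Injective G.toLinearMap := by
    rw [injective_iff_map_eq_zero]
    intro z hz
    have h1 : ⟪T z, T z⟫ = 0 := congrArg (fun L : E →L[ℝ] ℝ => L z) hz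
    exact (injective_iff_map_eq_zero T).1 hT z (inner_self_eq_zero.1 h1)
  have hfin : Module.finrank ℝ E = Module.finrank ℝ (E →L[ℝ] ℝ) :=
    (Subspace.dual_finrank_eq (K := ℝ) (V := E)).symm.trans
      (LinearMap.toContinuousLinearMap (𝕜 := ℝ) (E := E) (F' := ℝ)).finrank_eq
  refine ⟨(LinearEquiv.ofBijective G.toLinearMap ⟨hinj,
    (LinearMap.injective_iff_surjective_of_finrank_eq_finrank hfin).1 hinj⟩).toContinuousLinearEquiv,
    ?_⟩
  ext1 z
  rfl

/-- The gradient of a smooth function with respect to an induced metric is differentiable. -/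
theorem diffAt_grad (hf : IsIsometricImmersion met f) {u : M → ℝ}
    (hu : ContMDiff (𝓡 n) 𝓘(ℝ) ∞ u) (p : M) : DiffAt (grad met u) p := by
  have hp := mem_extChartAt_source (I := 𝓡 n) p
  have ht := mem_extChartAt_target (I := 𝓡 n) p
  let T := pullForm p (mvfderiv (𝓡 n) f)
  let θ := pullForm p (mvfderiv (𝓡 n) u)
  -- In the chart the gradient is the inverse Gram form of `df` applied to `du`. Its
  -- differentiability matters because `leviCivita` takes the value zero at points where a field is
  -- not differentiable.
  let G : EuclideanSpace ℝ (Fin n) → EuclideanSpace ℝ (Fin n) →L[ℝ] EuclideanSpace ℝ (Fin n) →L[ℝ] ℝ :=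
    fun w => (ContinuousLinearMap.compL ℝ _ _ ℝ).flip (T w) ∘L (innerSL ℝ ∘L T w)
  have hTd : DifferentiableAt ℝ T (extChartAt (𝓡 n) p p) :=
    ((contDiffOn_pullForm_mvfderiv hf.smooth p).contDiffAt
      ((isOpen_target p).mem_nhds ht)).differentiableAt (by simp)
  have hθd : DifferentiableAt ℝ θ (extChartAt (𝓡 n) p p) :=
    ((contDiffOn_pullForm_mvfderiv hu p).contDiffAt
      ((isOpen_target p).mem_nhds ht)).differentiableAt (by simp)
  have hGd : DifferentiableAt ℝ G (extChartAt (𝓡 n) p p) :=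
    ((ContinuousLinearMap.differentiableAt _).comp _ hTd).clm_comp
      ((differentiableAt_const _).clm_comp hTd)
  have hGi : ∀ q ∈ (extChartAt (𝓡 n) p).source, (G (extChartAt (𝓡 n) p q)).IsInvertible := by
    intro q hq
    refine isInvertible_gram ?_
    have hq' := (extChartAt (𝓡 n) p).map_target ((extChartAt (𝓡 n) p).map_source hq)
    exact (injective_mvfderiv hf _).comp (frame_bijective hq').1
  rw [diffAt_iff_coord hp]
  have hinv : DifferentiableAt ℝ (fun w => (G w).inverse (θ w)) (extChartAt (𝓡 n) p p) := by
    obtain ⟨e, he⟩ := hGi p hp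
    have h1 := (contDiffAt_map_inverse (𝕜 := ℝ) (n := 1) e).differentiableAt (by simp)
    rw [he] at h1
    exact (h1.comp _ hGd).clm_apply hθd
  refine (mdifferentiableAt_comp_extChartAt hp hinv).congr_of_eventuallyEq ?_
  filter_upwards [(isOpen_extChartAt_source p).mem_nhds hp] with q hq
  refine ((hGi q hq).inverse_apply_eq.2 ?_).symm
  ext1 w
  change pullForm p (mvfderiv (𝓡 n) u) _ w = ⟪pullForm p (mvfderiv (𝓡 n) f) _ (coord p _ q),
    pullForm p (mvfderiv (𝓡 n) f) _ w⟫
  rw [pullForm_extChartAt hq, pullForm_extChartAt hq, pullForm_extChartAt hq, frame_coord hq,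
    hf.isometric, grad, inner_sharp]

theorem mdifferentiableAt_grad_add_normal (hf : IsIsometricImmersion met f)
    (hN : IsUnitNormal f N) {u h : M → ℝ} (hu : ContMDiff (𝓡 n) 𝓘(ℝ) ∞ u)
    (hh : ContMDiff (𝓡 n) 𝓘(ℝ) ∞ h) (p : M) :
    MDifferentiableAt (𝓡 n) 𝓘(ℝ, EuclideanSpace ℝ (Fin (n + 1)))
      (fun q => mvfderiv (𝓡 n) f q (grad met u q) + h q • N q) p :=
  (mdifferentiableAt_mvfderiv_apply hf.smooth (diffAt_grad hf hu p)).add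
    (((hh p).mdifferentiableAt (by simp)).smul ((hN.smooth p).mdifferentiableAt (by simp)))

/-- The differential of `df (grad u) + h N`. -/
theorem mvfderiv_grad_add_normal (hf : IsIsometricImmersion met f) (hN : IsUnitNormal f N)
    (hA : IsShapeOperator f N A) {u h : M → ℝ} (hu : ContMDiff (𝓡 n) 𝓘(ℝ) ∞ u)
    (hh : ContMDiff (𝓡 n) 𝓘(ℝ) ∞ h) (p : M) (v : TangentSpace (𝓡 n) p) :
    mvfderiv (𝓡 n) (fun q => mvfderiv (𝓡 n) f q (grad met u q) + h q • N q) p v =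
      mvfderiv (𝓡 n) f p (leviCivita met (grad met u) p v - h p • A p v) +
        met.inner p (A p (grad met u p) + grad met h p) v • N p := by
  have hg := diffAt_grad hf hu p
  have hhd := (hh p).mdifferentiableAt (by simp)
  have hNd := (hN.smooth p).mdifferentiableAt (by simp)
  have h1 := mvfderiv_add (mdifferentiableAt_mvfderiv_apply hf.smooth hg) (hhd.smul hNd)
  have h2 := mvfderiv_smul hhd hNd
  refine (congrArg (fun L => L v) h1).trans ?_
  change mvfderiv (𝓡 n) (fun q => mvfderiv (𝓡 n) f q (grad met u q)) p v +
    mvfderiv (𝓡 n) (h • N) p v = _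
  rw [h2, gauss_formula hf hN hA hg]
  simp only [add_apply, smul_apply, ContinuousLinearMap.smulRight_apply, map_sub, map_smul,
    map_add, hA p v]
  have h3 : met.inner p (grad met h p) v = mvfderiv (𝓡 n) h p v := inner_sharp met p _ v
  rw [h3, shape_selfAdjoint hf hN hA p (grad met u p), met.symm p (grad met u p)]
  module

/-- A potential pair `u, h` of `Q` gives a primitive of `df ∘ Q`. -/
theorem mvfderiv_eq_of_potentialPair (hf : IsIsometricImmersion met f) (hN : IsUnitNormal f N)
    (hA : IsShapeOperator f N A) {u h : M → ℝ} (huh : IsPotentialPair met A Q u h) (p : M)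
    (v : TangentSpace (𝓡 n) p) :
    mvfderiv (𝓡 n) (fun q => mvfderiv (𝓡 n) f q (grad met u q) + h q • N q) p v =
      mvfderiv (𝓡 n) f p (Q p v) := by
  rw [mvfderiv_grad_add_normal hf hN hA huh.smooth_left huh.smooth_right, ← huh.hessian,
    huh.shape_grad, neg_add_cancel, map_zero, zero_apply, zero_smul, add_zero]

/-- The 1-form `⟨F, df⟩` is exact if `dF = df ∘ Q` for a self-adjoint `Q`. -/
theorem exists_mvfderiv_eq_inner [T2Space M] [SimplyConnectedSpace M]
    (hf : IsIsometricImmersion met f)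
    (hQ : ∀ (p : M) (v w : TangentSpace (𝓡 n) p), met.inner p (Q p v) w = met.inner p v (Q p w))
    {F : M → EuclideanSpace ℝ (Fin (n + 1))}
    (hF : ContMDiff (𝓡 n) 𝓘(ℝ, EuclideanSpace ℝ (Fin (n + 1))) ∞ F)
    (hd : ∀ p, mvfderiv (𝓡 n) F p = mvfderiv (𝓡 n) f p ∘L Q p) :
    ∃ u : M → ℝ, ContMDiff (𝓡 n) 𝓘(ℝ) ∞ u ∧
      ∀ p v, mvfderiv (𝓡 n) u p v = ⟪F p, mvfderiv (𝓡 n) f p v⟫ := by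
  let η : Π p : M, TangentSpace (𝓡 n) p →L[ℝ] ℝ := fun p => innerSL ℝ (F p) ∘L mvfderiv (𝓡 n) f p
  have hη : ∀ p₀ : M, pullForm p₀ η = fun w => innerSL ℝ ((F ∘ (extChartAt (𝓡 n) p₀).symm) w) ∘L
      pullForm p₀ (mvfderiv (𝓡 n) f) w := fun _ => rfl
  obtain ⟨u, hu, hu'⟩ := exists_mvfderiv_eq_of_closed η
    (fun p₀ => by
      rw [hη]
      exact ((innerSL ℝ).contDiff.comp_contDiffOn (contDiffOn_comp_extChartAt_symm hF p₀)).clm_comp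
        (contDiffOn_pullForm_mvfderiv hf.smooth p₀))
    (fun p₀ => by
      filter_upwards [(isOpen_target p₀).mem_nhds (mem_extChartAt_target p₀)] with w hw x y
      have h1 := hasFDerivAt_comp_extChartAt_symm hw ((hF _).mdifferentiableAt (by simp))
      have h2 := (((contDiffOn_pullForm_mvfderiv hf.smooth p₀).contDiffAt
        ((isOpen_target p₀).mem_nhds hw)).differentiableAt (by simp)).hasFDerivAt
      have h3 := ((innerSL ℝ).hasFDerivAt.comp w h1).clm_comp h2
      -- The derivative of `⟨F, df⟩` is a Hessian term of `f` plus `⟨Qx, y⟩`, and both are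
      -- symmetric.
      have h4 : ∀ x y, fderiv ℝ (pullForm p₀ η) w x y =
          ⟪F ((extChartAt (𝓡 n) p₀).symm w),
            fderiv ℝ (pullForm p₀ (mvfderiv (𝓡 n) f)) w x y⟫ +
          met.inner _ (Q _ (frame p₀ ((extChartAt (𝓡 n) p₀).symm w) x)) (frame p₀ _ y) := by
        intro x y
        rw [← hf.isometric, hη]
        refine (congrArg (fun L => L x y) h3.fderiv).trans ?_
        simp [pullForm, hd, -extChartAt]
        rfl
      rw [h4, h4, fderiv_pullForm_mvfderiv_symm hf.smooth hw, hQ, met.symm])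
  exact ⟨u, hu, fun p v => by rw [hu']; rfl⟩

/-- A primitive of `df ∘ Q` gives a potential pair of `Q`. -/
theorem exists_potentialPair [T2Space M] [SimplyConnectedSpace M]
    (hf : IsIsometricImmersion met f) (hN : IsUnitNormal f N) (hA : IsShapeOperator f N A)
    (hQ : ∀ (p : M) (v w : TangentSpace (𝓡 n) p), met.inner p (Q p v) w = met.inner p v (Q p w))
    {F : M → EuclideanSpace ℝ (Fin (n + 1))}
    (hF : ContMDiff (𝓡 n) 𝓘(ℝ, EuclideanSpace ℝ (Fin (n + 1))) ∞ F)
    (hd : ∀ p, mvfderiv (𝓡 n) F p = mvfderiv (𝓡 n) f p ∘L Q p) :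
    ∃ u h : M → ℝ, IsPotentialPair met A Q u h := by
  obtain ⟨u, hu, hdu⟩ := exists_mvfderiv_eq_inner hf hQ hF hd
  let h : M → ℝ := fun p => ⟪F p, N p⟫
  have hh : ContMDiff (𝓡 n) 𝓘(ℝ) ∞ h := hF.inner_vector hN.smooth
  have hgrad : ∀ p w, met.inner p (grad met u p) w = ⟪F p, mvfderiv (𝓡 n) f p w⟫ := fun p w =>
    (inner_sharp met p _ w).trans (hdu p w)
  -- By the choice of `u` and `h`, this is the splitting of `F` into tangential and normal parts.
  -- Comparing its differential with `df ∘ Q` gives the shape equation in the normal part and the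
  -- Hessian equation in the tangential part.
  have hFeq : (fun p => mvfderiv (𝓡 n) f p (grad met u p) + h p • N p) = F := by
    funext p
    refine eq_of_inner_tangent_normal hf hN (p := p) (fun z => ?_) ?_
    · rw [inner_add_left, hf.isometric, hgrad, real_inner_smul_left, hN.normal, mul_zero, add_zero]
    · rw [inner_add_left, real_inner_smul_left, real_inner_self_eq_norm_sq, hN.norm_eq,
        real_inner_comm, hN.normal, one_pow, mul_one, zero_add]
  have hder := fun p v => mvfderiv_grad_add_normal hf hN hA hu hh p v
  simp only [hFeq, hd, ContinuousLinearMap.comp_apply] at hder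
  have hnormal : ∀ p v, met.inner p (A p (grad met u p) + grad met h p) v = 0 := by
    intro p v
    have h1 := congrArg (fun z => ⟪N p, z⟫) (hder p v)
    rw [inner_add_right, hN.normal, hN.normal, inner_smul_right, real_inner_self_eq_norm_sq,
      hN.norm_eq, one_pow, mul_one, zero_add] at h1
    exact h1.symm
  refine ⟨u, h, hu, hh, fun p => ?_, fun p v => ?_⟩
  · rw [← add_eq_zero_iff_eq_neg]
    exact eq_of_inner_eq met p fun w => by rw [hnormal, map_zero, zero_apply]
  · apply injective_mvfderiv hf p
    rw [hder, hnormal, zero_smul, add_zero]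

end Gradient

/-! ### Congruence and transport of normals -/

section Rigidity

variable {n : ℕ} {M : Type*} [TopologicalSpace M] [ChartedSpace (EuclideanSpace ℝ (Fin n)) M]
  [IsManifold (𝓡 n) ∞ M] {met : Metric n M} {f f' N : M → EuclideanSpace ℝ (Fin (n + 1))}
  {A Q : Π p : M, TangentSpace (𝓡 n) p →L[ℝ] TangentSpace (𝓡 n) p}

/-- Maps whose differentials agree up to a linear isometry are congruent. -/
theorem exists_isometryEquiv_of_mvfderiv_eq {V : Type*} [NormedAddCommGroup V] [NormedSpace ℝ V]
    [PreconnectedSpace M] {F G : M → V}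
    (hF : ∀ p, MDifferentiableAt (𝓡 n) 𝓘(ℝ, V) F p) (hG : ∀ p, MDifferentiableAt (𝓡 n) 𝓘(ℝ, V) G p)
    (Ψ : V ≃ₗᵢ[ℝ] V) (h : ∀ p v, mvfderiv (𝓡 n) G p v = Ψ (mvfderiv (𝓡 n) F p v)) :
    ∃ τ : V ≃ᵢ V, ∀ p, G p = τ (F p) := by
  rcases isEmpty_or_nonempty M with hM | ⟨⟨p₀⟩⟩
  · exact ⟨IsometryEquiv.refl V, fun p => hM.elim p⟩
  · refine ⟨Ψ.toIsometryEquiv.trans (IsometryEquiv.addRight (G p₀ - Ψ (F p₀))), fun p => ?_⟩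
    have hd : ∀ p, MDifferentiableAt (𝓡 n) 𝓘(ℝ, V) (fun q => Ψ (F q)) p := fun p =>
      Ψ.toContinuousLinearEquiv.differentiable.differentiableAt.mdifferentiableAt.comp p (hF p)
    have h1 := eq_add_const_of_mvfderiv_eq hG hd (fun p => by
      ext1 v
      rw [h]
      exact (mvfderiv_linearIsometry_comp Ψ.toLinearIsometry (hF p) v).symm) p p₀
    change G p = Ψ (F p) + (G p₀ - Ψ (F p₀))
    rw [← h1, add_sub_cancel]

omit [IsManifold (𝓡 n) ∞ M] in
theorem isUnitNormal_comp {Ψ : EuclideanSpace ℝ (Fin (n + 1)) ≃ₗᵢ[ℝ] EuclideanSpace ℝ (Fin (n + 1))}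
    (hN : IsUnitNormal f N) (h : ∀ p v, mvfderiv (𝓡 n) f' p v = Ψ (mvfderiv (𝓡 n) f p (Q p v))) :
    IsUnitNormal f' (fun p => Ψ (N p)) where
  smooth := Ψ.contDiff.contMDiff.comp hN.smooth
  norm_eq p := by rw [Ψ.norm_map, hN.norm_eq]
  normal p v := by rw [h, Ψ.inner_map_map, hN.normal]

-- From `d(Ψ N) = -Ψ df A = -Ψ df Q (Q⁻¹A) = -df' (Q⁻¹A)`.
omit [IsManifold (𝓡 n) ∞ M] in
theorem isShapeOperator_comp
    {Ψ : EuclideanSpace ℝ (Fin (n + 1)) ≃ₗᵢ[ℝ] EuclideanSpace ℝ (Fin (n + 1))}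
    (hN : IsUnitNormal f N) (hA : IsShapeOperator f N A) (hns : ∀ p, (Q p).IsInvertible)
    (h : ∀ p v, mvfderiv (𝓡 n) f' p v = Ψ (mvfderiv (𝓡 n) f p (Q p v))) :
    IsShapeOperator f' (fun p => Ψ (N p)) (fun p => (Q p).inverse ∘L A p) := by
  intro p v
  rw [h, ContinuousLinearMap.comp_apply, (hns p).self_apply_inverse, ← map_neg, ← hA]
  exact mvfderiv_linearIsometry_comp Ψ.toLinearIsometry ((hN.smooth p).mdifferentiableAt (by simp)) v

/-- A unit normal vector field of a connected hypersurface is unique up to sign. -/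
theorem unitNormal_eq_or_eq_neg [PreconnectedSpace M] (hf : IsIsometricImmersion met f)
    {N' : M → EuclideanSpace ℝ (Fin (n + 1))} (hN : IsUnitNormal f N) (hN' : IsUnitNormal f N') :
    N' = N ∨ N' = -N := by
  have h1 : ∀ p, N' p = ⟪N' p, N p⟫ • N p := fun p =>
    eq_of_inner_tangent_normal hf hN (p := p)
      (fun z => by rw [hN'.normal, real_inner_smul_left, hN.normal, mul_zero])
      (by rw [real_inner_smul_left, real_inner_self_eq_norm_sq, hN.norm_eq, one_pow, mul_one])
  have h2 : ∀ p, ⟪N' p, N p⟫ ^ 2 = 1 := by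
    intro p
    have h3 := congrArg norm (h1 p)
    rw [norm_smul, hN.norm_eq, hN'.norm_eq, mul_one, Real.norm_eq_abs] at h3
    rw [← sq_abs, ← h3, one_pow]
  have h4 := isPreconnected_univ.eq_or_eq_neg_of_sq_eq (f := fun p : M => ⟪N' p, N p⟫)
    (g := fun _ => (1 : ℝ)) (hN'.smooth.continuous.inner hN.smooth.continuous).continuousOn
    continuousOn_const (fun p _ => by simp [h2]) (fun _ => one_ne_zero)
  refine h4.imp (fun h => funext fun p => ?_) (fun h => funext fun p => ?_)
  · have h5 : ⟪N' p, N p⟫ = 1 := h (Set.mem_univ p)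
    rw [h1, h5, one_smul]
  · have h5 : ⟪N' p, N p⟫ = -1 := h (Set.mem_univ p)
    rw [h1, h5, neg_one_smul, Pi.neg_apply]

omit [IsManifold (𝓡 n) ∞ M] in
theorem isShapeOperator_neg (hN : IsUnitNormal f N) (hA : IsShapeOperator f N A) :
    IsShapeOperator f (-N) (fun p => -A p) := by
  intro p v
  have h1 := mvfderiv_linearIsometry_comp (LinearIsometryEquiv.neg ℝ).toLinearIsometry
    ((hN.smooth p).mdifferentiableAt (by simp)) v
  refine h1.trans ?_
  rw [hA]
  simp

end Rigidity

/-! ### The main theorem -/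

theorem theorem1 {n : ℕ} {M : Type*} [TopologicalSpace M] [T2Space M] [SecondCountableTopology M]
    [ChartedSpace (EuclideanSpace ℝ (Fin n)) M] [IsManifold (𝓡 n) ∞ M] [SimplyConnectedSpace M]
    (met : Metric n M) (f N : M → EuclideanSpace ℝ (Fin (n + 1)))
    (A Q : Π p : M, TangentSpace (𝓡 n) p →L[ℝ] TangentSpace (𝓡 n) p)
    (hf : IsIsometricImmersion met f) (hN : IsUnitNormal f N) (hA : IsShapeOperator f N A)
    (hrank : ∀ p, 3 ≤ Module.finrank ℝ (LinearMap.range (A p).toLinearMap))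
    (hQ : IsCodazzi met Q) (hns : ∀ p, (Q p).IsInvertible) :
    -- (i) existence
    ((∃ f' : M → EuclideanSpace ℝ (Fin (n + 1)),
        IsIsometricImmersion (sqMetric met Q hQ hns) f') ↔
      ∀ p, Q p ∘L A p = A p ∘L Q p) ∧
    -- (i) rigidity and shape operator
    (∀ f' : M → EuclideanSpace ℝ (Fin (n + 1)),
      IsIsometricImmersion (sqMetric met Q hQ hns) f' →
        (∀ f'' : M → EuclideanSpace ℝ (Fin (n + 1)),
          IsIsometricImmersion (sqMetric met Q hQ hns) f'' →
            ∃ τ : EuclideanSpace ℝ (Fin (n + 1)) ≃ᵢ EuclideanSpace ℝ (Fin (n + 1)),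
              ∀ p, f'' p = τ (f' p)) ∧
        (∃ N' : M → EuclideanSpace ℝ (Fin (n + 1)), IsUnitNormal f' N') ∧
        (∀ N' : M → EuclideanSpace ℝ (Fin (n + 1)), IsUnitNormal f' N' →
          IsShapeOperator f' N' (fun p => (Q p).inverse ∘L A p) ∨
          IsShapeOperator f' N' (fun p => -((Q p).inverse ∘L A p)))) ∧
    -- (ii)
    ((∀ p, Q p ∘L A p = A p ∘L Q p) →
      (∃ u h : M → ℝ, IsPotentialPair met A Q u h) ∧
      ∀ u h : M → ℝ, IsPotentialPair met A Q u h →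
        ∀ f' : M → EuclideanSpace ℝ (Fin (n + 1)),
          IsIsometricImmersion (sqMetric met Q hQ hns) f' →
            ∃ τ : EuclideanSpace ℝ (Fin (n + 1)) ≃ᵢ EuclideanSpace ℝ (Fin (n + 1)),
              ∀ p, f' p = τ (mvfderiv (𝓡 n) f p (grad met u p) + h p • N p)) := by
  -- The first map need only be differentiable with differential `Ψ ∘ df ∘ Q`. This serves both
  -- rigidity and part (ii), where `df (grad u) + h N` is known only to be differentiable and `Ψ` is
  -- the identity.
  have hcong : ∀ f' f'' : M → EuclideanSpace ℝ (Fin (n + 1)),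
      (∀ p, MDifferentiableAt (𝓡 n) 𝓘(ℝ, EuclideanSpace ℝ (Fin (n + 1))) f' p) →
      (∃ Ψ : EuclideanSpace ℝ (Fin (n + 1)) ≃ₗᵢ[ℝ] EuclideanSpace ℝ (Fin (n + 1)),
        ∀ p v, mvfderiv (𝓡 n) f' p v = Ψ (mvfderiv (𝓡 n) f p (Q p v))) →
      IsIsometricImmersion (sqMetric met Q hQ hns) f'' →
      ∃ τ : EuclideanSpace ℝ (Fin (n + 1)) ≃ᵢ EuclideanSpace ℝ (Fin (n + 1)),
        ∀ p, f'' p = τ (f' p) := by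
    rintro f' f'' hd ⟨Ψ, hΨ⟩ hf''
    obtain ⟨Ψ', hΨ'⟩ := exists_linearIsometryEquiv_mvfderiv_eq hf hN hA hrank hQ hns hf''
    refine exists_isometryEquiv_of_mvfderiv_eq hd
      (fun p => (hf''.smooth p).mdifferentiableAt (by simp)) (Ψ.symm.trans Ψ') fun p v => ?_
    rw [hΨ', hΨ, LinearIsometryEquiv.trans_apply, LinearIsometryEquiv.symm_apply_apply]
  refine ⟨⟨fun ⟨f', hf'⟩ => comp_eq_comp_of_isometricImmersion hf hN hA hrank hQ hns hf',
    fun hcomm => ?_⟩, fun f' hf' => ?_, fun hcomm => ⟨?_, fun u h huh f' hf' => ?_⟩⟩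
  · obtain ⟨F, hF, hd⟩ := exists_mvfderiv_eq_comp hf hN hA hQ hcomm
    exact ⟨F, isIsometricImmersion_of_mvfderiv_eq hf hQ hns hF hd⟩
  · obtain ⟨Ψ, hΨ⟩ := exists_linearIsometryEquiv_mvfderiv_eq hf hN hA hrank hQ hns hf'
    have hN₁ := isUnitNormal_comp hN hΨ
    have hA₁ := isShapeOperator_comp hN hA hns hΨ
    refine ⟨fun f'' hf'' => hcong f' f'' (fun p => (hf'.smooth p).mdifferentiableAt (by simp))
      ⟨Ψ, hΨ⟩ hf'', ⟨_, hN₁⟩, fun N' hN' => ?_⟩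
    rcases unitNormal_eq_or_eq_neg hf' hN₁ hN' with rfl | rfl
    · exact Or.inl hA₁
    · exact Or.inr (isShapeOperator_neg hN₁ hA₁)
  · obtain ⟨F, hF, hd⟩ := exists_mvfderiv_eq_comp hf hN hA hQ hcomm
    exact exists_potentialPair hf hN hA hQ.selfAdjoint hF hd
  · exact hcong _ f' (mdifferentiableAt_grad_add_normal hf hN huh.smooth_left huh.smooth_right)
      ⟨LinearIsometryEquiv.refl ℝ _, mvfderiv_eq_of_potentialPair hf hN hA huh⟩ hf'
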